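/- All locally compact spaces are Hausdorff and second countable. A function $(t,w)\mapsto f(t,w)$ on an open subset of $T\times\mathbb{R}^k$ ($T$ a locally compact space) is of class $C^{\infty,0}$ if each $f(t,\cdot)$ is smooth and $t\mapsto f(t,\cdot)$ is locally continuous for the topology of uniform convergence on compact sets of all derivatives in $w$. A continuous family of manifolds over $T$ is a locally compact space $X$ with a continuous open surjection $p:X\to T$ and an atlas of fibre-preserving homeomorphisms $U\to p(U)\times W$ ($U\subset X$ open, $W\subset\mathbb{R}^k$ open, $k\ge 0$ fixed) whose transition maps are $C^{\infty,0}$. A morphism ($C^{\infty,0}$ map) from $(X_1,p_1)$ over $T_1$ to $(X_2,p_2)$ over $T_2$ is a pair of continuous maps $f:X_1\to X_2$, $q:T_1\to T_2$ with $p_2\circ f=q\circ p_1$ such that in charts $f(t,w)=(q(t),f^t(w))$ with $(t,w)\mapsto f^t(w)$ of class $C^{\infty,0}$. If $p:X\to T$ is a continuous family and $t:Z\to T$ is continuous, then $\{(z,x):t(z)=p(x)\}$ is a continuous family over $Z$ with projection $(z,x)\mapsto z$. A continuous family groupoid is a locally compact topological groupoid $G$, with range and source maps $r,s:G\to G^0$,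 such that $(G,r)$ and $(G,s)$ are continuous families over $G^0$, inversion $(G,r)\to(G,s)$ and its inverse are $C^{\infty,0}$ over $\mathrm{id}_{G^0}$, and multiplication, from the family $\{(g,h):s(g)=r(h)\}$ over $G$ with projection $(g,h)\mapsto g$ to $(G,r)$, is a morphism over $r$. A $C^{\infty,0}$ $G$-space is a continuous family $(X,p)$ over $G^0$ with a continuous $G$-action $(g,x)\mapsto gx$ (for $s(g)=p(x)$) which is a morphism over $r$ from the family $\{(g,x):s(g)=p(x)\}$ over $G$ to $(X,p)$; it is proper if $(g,x)\mapsto(gx,x)$ is a proper map into $X\times X$. A $C^{\infty,0}$ $G$-vector bundle over $X$ is a finite rank continuous complex vector bundle $\pi:E\to X$ with a continuous action of $G$ on $E$ by linear maps $E^x\to E^{gx}$, such that $(E,p\circ\pi)$ is a $C^{\infty,0}$ $G$-space and $E$ has, near each point of $X$, linear local trivializations which are $C^{\infty,0}$ in both directions. A hermitian metric $\gamma=\{\gamma^x\}_{x\in X}$ on $E$ (a positive definite hermitian inner product on each $E^x$) is $C^{\infty,0}$ if $x\mapsto\gamma^x(\sigma(x),\tau(x))$ is a $C^{\infty,0}$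 function $X\to\mathbb{C}$ for all $C^{\infty,0}$ sections $\sigma,\tau$ of $E$. Proposition. Let $G$ be a continuous family groupoid, $(X,p)$ a proper $C^{\infty,0}$ $G$-space and $E$ a $C^{\infty,0}$ $G$-vector bundle over $X$. Then there exists a $C^{\infty,0}$ hermitian metric $\gamma$ on $E$ which is $G$-isometric: $\gamma^{gx}(g\xi,g\eta)=\gamma^x(\xi,\eta)$ for all $g\in G$, $x\in X$ with $s(g)=p(x)$ and $\xi,\eta\in E^x$. -/

import Mathlib

open Set Filter Topology Bundle
open scoped ContDiff ComplexConjugate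

noncomputable section

namespace CFam

/-! ### Functions of class `C^{∞,0}` on open subsets of `T × V` -/

section Local

variable {T T' V V' V₁ V₁' : Type*} [TopologicalSpace T] [TopologicalSpace T']
  [NormedAddCommGroup V] [NormedSpace ℝ V] [NormedAddCommGroup V'] [NormedSpace ℝ V']
  [NormedAddCommGroup V₁] [NormedSpace ℝ V₁] [NormedAddCommGroup V₁'] [NormedSpace ℝ V₁']

/-- `f` is of class `C^{∞,0}` on the open set `U ⊆ T × V`: on each slice `{w | (t, w) ∈ U}` the map
`f (t, ·)` is smooth, and `f (t, ·) → f (t₀, ·)` as `t → t₀`, uniformly on compact subsets of the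
slice of `U` over `t₀` together with all derivatives in the `V`-direction. (`K` is contained in the
slice of `U` over `t` as soon as `t` is close to `t₀`, so the values of `f` outside `U` are
irrelevant. If `U = A ×ˢ W`, this is the continuity of `t ↦ f (t, ·)` from `A` to `C^∞(W, V')`.) -/
def IsCInfZeroOn (f : T × V → V') (U : Set (T × V)) : Prop :=
  (∀ t, ContDiffOn ℝ ∞ (fun w => f (t, w)) {w | (t, w) ∈ U}) ∧
  ∀ (n : ℕ) (t₀ : T) (K : Set V), IsCompact K → (∀ w ∈ K, (t₀, w) ∈ U) →
    TendstoUniformlyOn (fun t w => iteratedFDeriv ℝ n (fun v => f (t, v)) w)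
      (fun w => iteratedFDeriv ℝ n (fun v => f (t₀, v)) w) (𝓝 t₀) K

theorem IsCInfZeroOn.congr {f g : T × V → V'} {U : Set (T × V)} (hf : IsCInfZeroOn f U)
    (hU : IsOpen U) (h : EqOn f g U) : IsCInfZeroOn g U := by
  have key : ∀ (n : ℕ) (t : T) (w : V), (t, w) ∈ U →
      iteratedFDeriv ℝ n (fun v => f (t, v)) w = iteratedFDeriv ℝ n (fun v => g (t, v)) w := by
    intro n t w hw
    have hs : {v | (t, v) ∈ U} ∈ 𝓝 w :=
      (hU.preimage (Continuous.prodMk_right t)).mem_nhds hw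
    refine (Filter.EventuallyEq.iteratedFDeriv ℝ ?_ n).eq_of_nhds
    filter_upwards [hs] with v hv using h hv
  refine ⟨fun t => (hf.1 t).congr fun w hw => (h hw).symm, fun n t₀ K hK hKU => ?_⟩
  have ev : ∀ᶠ t in 𝓝 t₀, ∀ w ∈ K, (t, w) ∈ U :=
    hK.eventually_forall_of_forall_eventually fun w hw => hU.mem_nhds (hKU w hw)
  refine ((hf.2 n t₀ K hK hKU).congr ?_).congr_right ?_
  · filter_upwards [ev] with t ht w hw using key n t w (ht w hw)
  · exact fun w hw => key n t₀ w (hKU w hw)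

/-- Change of parameter space along a continuous map. -/
theorem IsCInfZeroOn.comp_base {f : T × V → V'} {U : Set (T × V)} (hf : IsCInfZeroOn f U)
    {q : T' → T} (hq : Continuous q) :
    IsCInfZeroOn (fun z : T' × V => f (q z.1, z.2)) {z | (q z.1, z.2) ∈ U} :=
  ⟨fun t => hf.1 (q t), fun n t₀ K hK hKU u hu =>
    (hq.tendsto t₀).eventually (hf.2 n (q t₀) K hK hKU u hu)⟩

/-- Composition with linear maps in the fibre direction, up to adding a parameter-free smooth
map. -/
theorem IsCInfZeroOn.linear {f : T × V → V'} {U : Set (T × V)} (hf : IsCInfZeroOn f U)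
    (hU : IsOpen U) (L : V₁ →L[ℝ] V) (M : V' →L[ℝ] V₁') {c : V₁ → V₁'} (hc : ContDiff ℝ ∞ c) :
    IsCInfZeroOn (fun z : T × V₁ => M (f (z.1, L z.2)) + c z.2) {z | (z.1, L z.2) ∈ U} := by
  have hopen : ∀ t, IsOpen {w | (t, w) ∈ U} := fun t => hU.preimage (Continuous.prodMk_right t)
  have hcd : ∀ t, ContDiffOn ℝ ∞ (fun w => f (t, L w)) {w | (t, L w) ∈ U} := fun t =>
    (hf.1 t).comp (t := {w | (t, w) ∈ U}) L.contDiff.contDiffOn fun w hw => hw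
  refine ⟨fun t => ((M.contDiff.comp_contDiffOn (hcd t)).add hc.contDiffOn), ?_⟩
  intro n t₀ K hK hKU
  let Φ : ContinuousMultilinearMap ℝ (fun _ : Fin n => V) V' →L[ℝ]
      ContinuousMultilinearMap ℝ (fun _ : Fin n => V₁) V₁' :=
    (ContinuousLinearMap.compContinuousMultilinearMapL ℝ (fun _ : Fin n => V₁) V' V₁' M).comp
      (ContinuousMultilinearMap.compContinuousLinearMapL fun _ : Fin n => L)
  have key : ∀ (t : T) (w : V₁), (t, L w) ∈ U →
      iteratedFDeriv ℝ n (fun v => M (f (t, L v)) + c v) w =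
        Φ (iteratedFDeriv ℝ n (fun v => f (t, v)) (L w)) + iteratedFDeriv ℝ n c w := by
    intro t w hw
    have ho : IsOpen {v | (t, L v) ∈ U} := (hopen t).preimage L.continuous
    have h1 : ContDiffAt ℝ n (fun v => f (t, L v)) w :=
      (((hcd t) w hw).contDiffAt (ho.mem_nhds hw)).of_le (by exact_mod_cast le_top)
    have h2 : ContDiffAt ℝ n c w := hc.contDiffAt.of_le (by exact_mod_cast le_top)
    have h3 : iteratedFDeriv ℝ n (fun v => f (t, L v)) w =
        (iteratedFDeriv ℝ n (fun v => f (t, v)) (L w)).compContinuousLinearMap fun _ => L := by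
      have := L.iteratedFDerivWithin_comp_right (hf.1 t) (hopen t).uniqueDiffOn
        ho.uniqueDiffOn (x := w) hw (i := n) (by exact_mod_cast le_top)
      rw [iteratedFDerivWithin_of_isOpen n (hopen t) hw] at this
      rw [← this]
      exact (iteratedFDerivWithin_of_isOpen n ho hw).symm
    have h4 := M.iteratedFDeriv_comp_left h1 (i := n) le_rfl
    have h5 := iteratedFDeriv_add_apply (M.contDiff.contDiffAt.comp w h1) h2 (i := n)
    refine h5.trans ?_
    congr 1
    refine h4.trans ?_
    rw [h3]
    rfl
  have ev : ∀ᶠ t in 𝓝 t₀, ∀ w ∈ K, (t, L w) ∈ U :=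
    hK.eventually_forall_of_forall_eventually fun w hw =>
      (hU.preimage (by fun_prop : Continuous fun z : T × V₁ => (z.1, L z.2))).mem_nhds (hKU w hw)
  have base := hf.2 n t₀ (L '' K) (hK.image L.continuous) (by
    rintro _ ⟨w, hw, rfl⟩; exact hKU w hw)
  have base' := (Φ.uniformContinuous.comp_tendstoUniformlyOn (base.comp L)).mono
    (subset_preimage_image L K)
  have base'' : TendstoUniformlyOn
      (fun t w => Φ (iteratedFDeriv ℝ n (fun v => f (t, v)) (L w)) + iteratedFDeriv ℝ n c w)
      (fun w => Φ (iteratedFDeriv ℝ n (fun v => f (t₀, v)) (L w)) + iteratedFDeriv ℝ n c w)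
      (𝓝 t₀) K := by
    rw [Metric.tendstoUniformlyOn_iff] at base' ⊢
    intro ε hε
    filter_upwards [base' ε hε] with t ht w hw
    simpa using ht w hw
  refine (base''.congr ?_).congr_right ?_
  · filter_upwards [ev] with t ht w hw using (key t w (ht w hw)).symm
  · exact fun w hw => (key t₀ w (hKU w hw)).symm

end Local

/-! ### Continuous families of manifolds -/

/-- The structure of a continuous family of manifolds over `T` on `p : X → T`, the fibres being
manifolds modelled on the finite-dimensional real vector space `V`. An atlas determines its maximal
atlas, and the notion of morphism below does not change if the atlas is enlarged to the maximal
one. -/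
structure ContinuousFamily {T X : Type*} [TopologicalSpace T] [TopologicalSpace X]
    (V : Type*) [NormedAddCommGroup V] [NormedSpace ℝ V] (p : X → T) where
  continuous : Continuous p
  isOpenMap : IsOpenMap p
  surjective : Function.Surjective p
  atlas : Set (OpenPartialHomeomorph X (T × V))
  cover : ∀ x, ∃ e ∈ atlas, x ∈ e.source
  chart_fst : ∀ e ∈ atlas, ∀ x ∈ e.source, (e x).1 = p x
  chart_target : ∀ e ∈ atlas, ∃ W : Set V, IsOpen W ∧ e.target = (p '' e.source) ×ˢ W
  compat : ∀ e ∈ atlas, ∀ e' ∈ atlas,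
    IsCInfZeroOn (fun z => (e' (e.symm z)).2) (e.target ∩ e.symm ⁻¹' e'.source)

section Families

variable {T T₁ T₂ X X₁ X₂ Z V V₁ V₂ : Type*}
  [TopologicalSpace T] [TopologicalSpace T₁] [TopologicalSpace T₂]
  [TopologicalSpace X] [TopologicalSpace X₁] [TopologicalSpace X₂] [TopologicalSpace Z]
  [NormedAddCommGroup V] [NormedSpace ℝ V] [NormedAddCommGroup V₁] [NormedSpace ℝ V₁]
  [NormedAddCommGroup V₂] [NormedSpace ℝ V₂]

/-- `f`, defined on the open set `S ⊆ X₁`, is a `C^{∞,0}` map over `q`: it is continuous, maps the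
fibre over `t` to the fibre over `q t`, and in charts has the form `(t, w) ↦ (q t, f^t w)` with
`(t, w) ↦ f^t w` of class `C^{∞,0}`. -/
structure IsMorphismOn {p₁ : X₁ → T₁} {p₂ : X₂ → T₂} (A₁ : ContinuousFamily V₁ p₁)
    (A₂ : ContinuousFamily V₂ p₂) (q : T₁ → T₂) (f : X₁ → X₂) (S : Set X₁) : Prop where
  continuous_base : Continuous q
  continuousOn : ContinuousOn f S
  fiber : ∀ x ∈ S, p₂ (f x) = q (p₁ x)
  local_form : ∀ e₁ ∈ A₁.atlas, ∀ e₂ ∈ A₂.atlas,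
    IsCInfZeroOn (fun z => (e₂ (f (e₁.symm z))).2)
      (e₁.target ∩ e₁.symm ⁻¹' (S ∩ f ⁻¹' e₂.source))

/-- `(f, q)` is a morphism of continuous families (a `C^{∞,0}` map). -/
def IsMorphism {p₁ : X₁ → T₁} {p₂ : X₂ → T₂} (A₁ : ContinuousFamily V₁ p₁)
    (A₂ : ContinuousFamily V₂ p₂) (q : T₁ → T₂) (f : X₁ → X₂) : Prop :=
  IsMorphismOn A₁ A₂ q f univ

variable (V) in
/-- A vector space `V` as a continuous family over the one-point space. -/
def ContinuousFamily.point : ContinuousFamily V (fun _ : V => ()) where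
  continuous := continuous_const
  isOpenMap := fun _ _ => isOpen_discrete _
  surjective := fun _ => ⟨0, rfl⟩
  atlas := {(Homeomorph.punitProd V).symm.toOpenPartialHomeomorph}
  cover := fun _ => ⟨_, rfl, mem_univ _⟩
  chart_fst := fun _ _ _ _ => rfl
  chart_target := by
    rintro e rfl
    refine ⟨univ, isOpen_univ, ?_⟩
    ext z
    simp
  compat := by
    rintro e rfl e' rfl
    refine ⟨fun t => contDiff_id.contDiffOn, fun n t₀ K _ _ u hu => ?_⟩
    exact Eventually.of_forall fun t w _ => refl_mem_uniformity hu

/-- The trivial bundle `X × F`, as a continuous family over `T` with projection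
`(x, v) ↦ p x`. -/
def ContinuousFamily.prodModel {p : X → T} (A : ContinuousFamily V p) (F : Type*)
    [NormedAddCommGroup F] [NormedSpace ℝ F] :
    ContinuousFamily (V × F) (fun z : X × F => p z.1) where
  continuous := A.continuous.comp continuous_fst
  isOpenMap := A.isOpenMap.comp isOpenMap_fst
  surjective := fun t => let ⟨x, hx⟩ := A.surjective t; ⟨(x, 0), hx⟩
  atlas := (fun e => (e.prod (OpenPartialHomeomorph.refl F)).transHomeomorph
    (Homeomorph.prodAssoc T V F)) '' A.atlas
  cover := by
    rintro ⟨x, v⟩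
    obtain ⟨e, he, hx⟩ := A.cover x
    exact ⟨_, ⟨e, he, rfl⟩, by simpa using hx⟩
  chart_fst := by
    rintro _ ⟨e, he, rfl⟩ ⟨x, v⟩ hx
    exact A.chart_fst e he x (by simpa using hx)
  chart_target := by
    rintro _ ⟨e, he, rfl⟩
    obtain ⟨W, hW, h⟩ := A.chart_target e he
    refine ⟨W ×ˢ univ, hW.prod isOpen_univ, ?_⟩
    ext ⟨t, w, v⟩
    have h' : (t, w) ∈ e.target ↔ t ∈ p '' e.source ∧ w ∈ W := by rw [h]; rfl
    change (t, w) ∈ e.target ∧ v ∈ univ ↔ t ∈ (fun z : X × F => p z.1) '' (e.source ×ˢ univ) ∧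
      w ∈ W ∧ v ∈ univ
    rw [h']
    constructor
    · rintro ⟨⟨⟨x, hx, rfl⟩, hw⟩, hv⟩
      exact ⟨⟨(x, v), ⟨hx, trivial⟩, rfl⟩, hw, hv⟩
    · rintro ⟨⟨⟨x, v'⟩, ⟨hx, -⟩, rfl⟩, hw, hv⟩
      exact ⟨⟨⟨x, hx, rfl⟩, hw⟩, hv⟩
  compat := by
    rintro _ ⟨e, he, rfl⟩ _ ⟨e', he', rfl⟩
    have hU : IsOpen (e.target ∩ e.symm ⁻¹' e'.source) :=
      e.isOpen_inter_preimage_symm e'.open_source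
    have := (A.compat e he e' he').linear hU (ContinuousLinearMap.fst ℝ V F)
      (ContinuousLinearMap.inl ℝ V F) (c := fun z => ((0 : V), z.2)) (by fun_prop)
    convert this using 1
    · funext z
      change ((e' (e.symm (z.1, z.2.1))).2, z.2.2) =
        ((e' (e.symm (z.1, z.2.1))).2, (0 : F)) + ((0 : V), z.2.2)
      simp
    · ext z
      change ((z.1, z.2.1) ∈ e.target ∧ z.2.2 ∈ univ) ∧
        (e.symm (z.1, z.2.1) ∈ e'.source ∧ z.2.2 ∈ univ) ↔
        (z.1, z.2.1) ∈ e.target ∧ e.symm (z.1, z.2.1) ∈ e'.source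
      simp

/-- The total space of the pull-back of `p : X → T` along `t : Z → T`. -/
abbrev Pullback (t : Z → T) (p : X → T) : Type _ := {z : Z × X // t z.1 = p z.2}

open Classical in
/-- The chart of the pull-back family induced by the chart `e`: it sends `(z, x)` with `x` in the
domain of `e` to `(z, w)`, where `e x = (t z, w)`. -/
def pullbackChart {p : X → T} (A : ContinuousFamily V p) (t : Z → T) (ht : Continuous t)
    (e : OpenPartialHomeomorph X (T × V)) (he : e ∈ A.atlas) :
    OpenPartialHomeomorph (Pullback t p) (Z × V) where
  toFun y := (y.1.1, (e y.1.2).2)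
  invFun z :=
    if h : t z.1 = p (e.symm (t z.1, z.2)) then ⟨(z.1, e.symm (t z.1, z.2)), h⟩
    else ⟨(z.1, Function.surjInv A.surjective (t z.1)),
      (Function.surjInv_eq A.surjective (t z.1)).symm⟩
  source := {y | y.1.2 ∈ e.source}
  target := {z | (t z.1, z.2) ∈ e.target}
  map_source' := by
    rintro ⟨⟨z, x⟩, hz⟩ hx
    have h1 : (t z, (e x).2) = e x := Prod.ext (hz.trans (A.chart_fst e he x hx).symm) rfl
    simpa [h1] using e.map_source hx
  map_target' := by
    rintro ⟨z, w⟩ hw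
    have h1 : t z = p (e.symm (t z, w)) := by
      rw [← A.chart_fst e he _ (e.map_target hw), e.right_inv hw]
    simpa [dif_pos h1] using e.map_target hw
  left_inv' := by
    rintro ⟨⟨z, x⟩, hz⟩ hx
    have h1 : (t z, (e x).2) = e x := Prod.ext (hz.trans (A.chart_fst e he x hx).symm) rfl
    have h2 : e.symm (e x) = x := e.left_inv hx
    have h3 : t z = p (e.symm (t z, (e x).2)) := by rw [h1, h2]; exact hz
    have h4 : e.symm (t z, (e x).2) = x := by rw [h1, h2]
    rw [dif_pos h3]
    exact Subtype.ext (Prod.ext rfl h4)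
  right_inv' := by
    rintro ⟨z, w⟩ hw
    have h1 : t z = p (e.symm (t z, w)) := by
      rw [← A.chart_fst e he _ (e.map_target hw), e.right_inv hw]
    have h2 : e (e.symm (t z, w)) = (t z, w) := e.right_inv hw
    simp [dif_pos h1, h2]
  continuousOn_toFun := by
    refine ContinuousOn.prodMk (by fun_prop) (continuous_snd.comp_continuousOn ?_)
    exact e.continuousOn.comp (by fun_prop) fun y hy => hy
  continuousOn_invFun := by
    refine (IsInducing.subtypeVal.continuousOn_iff).2 ?_
    have : ContinuousOn (fun z : Z × V => (z.1, e.symm (t z.1, z.2)))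
        {z | (t z.1, z.2) ∈ e.target} :=
      ContinuousOn.prodMk (by fun_prop)
        (e.continuousOn_symm.comp (by fun_prop) fun y hy => hy)
    refine this.congr ?_
    rintro ⟨z, w⟩ hw
    have h1 : t z = p (e.symm (t z, w)) := by
      rw [← A.chart_fst e he _ (e.map_target hw), e.right_inv hw]
    simp [dif_pos h1]
  open_source := e.open_source.preimage (by fun_prop)
  open_target := e.open_target.preimage (by fun_prop)

open Classical in
theorem pullbackChart_symm_val {p : X → T} (A : ContinuousFamily V p) (t : Z → T)
    (ht : Continuous t) (e : OpenPartialHomeomorph X (T × V)) (he : e ∈ A.atlas) (z : Z × V)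
    (hz : (t z.1, z.2) ∈ e.target) :
    ((pullbackChart A t ht e he).symm z).1 = (z.1, e.symm (t z.1, z.2)) := by
  have h1 : t z.1 = p (e.symm (t z.1, z.2)) := by
    rw [← A.chart_fst e he _ (e.map_target hz), e.right_inv hz]
  exact congrArg Subtype.val (dif_pos h1)

/-- The pull-back family `t^*X = {(z, x) | t z = p x}` over `Z`, with projection `(z, x) ↦ z`. -/
def ContinuousFamily.pullback {p : X → T} (A : ContinuousFamily V p) (t : Z → T)
    (ht : Continuous t) : ContinuousFamily V (fun y : Pullback t p => y.1.1) where
  continuous := by fun_prop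
  isOpenMap := by
    rw [isOpenMap_iff_nhds_le]
    rintro ⟨⟨z, x⟩, hzx⟩ s hs
    rw [mem_map, nhds_subtype_eq_comap, mem_comap] at hs
    obtain ⟨u, hu, hus⟩ := hs
    obtain ⟨a, ha, b, hb, hab⟩ := mem_nhds_prod_iff.1 hu
    have h1 : p '' b ∈ 𝓝 (t z) := by
      have hzx' : t z = p x := hzx
      rw [hzx']
      exact A.isOpenMap.image_mem_nhds hb
    filter_upwards [ha, ht.continuousAt.preimage_mem_nhds h1] with z' hz' hz''
    obtain ⟨x', hx', hpx⟩ := hz''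
    exact @hus ⟨(z', x'), hpx.symm⟩ (hab ⟨hz', hx'⟩)
  surjective := fun z => let ⟨x, hx⟩ := A.surjective (t z); ⟨⟨(z, x), hx.symm⟩, rfl⟩
  atlas := {e' | ∃ (e : OpenPartialHomeomorph X (T × V)) (he : e ∈ A.atlas),
    e' = pullbackChart A t ht e he}
  cover := fun y => let ⟨e, he, hx⟩ := A.cover y.1.2; ⟨_, ⟨e, he, rfl⟩, hx⟩
  chart_fst := by
    rintro _ ⟨e, he, rfl⟩ y _
    rfl
  chart_target := by
    rintro _ ⟨e, he, rfl⟩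
    obtain ⟨W, hW, h⟩ := A.chart_target e he
    refine ⟨W, hW, ?_⟩
    ext ⟨z, w⟩
    change (t z, w) ∈ e.target ↔ z ∈ (fun y : Pullback t p => y.1.1) '' {y | y.1.2 ∈ e.source} ∧ w ∈ W
    rw [h]
    constructor
    · rintro ⟨⟨x, hx, hxt⟩, hw⟩
      exact ⟨⟨⟨(z, x), hxt.symm⟩, hx, rfl⟩, hw⟩
    · rintro ⟨⟨⟨⟨z', x⟩, hzx⟩, hx, rfl⟩, hw⟩
      exact ⟨⟨x, hx, hzx.symm⟩, hw⟩
  compat := by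
    rintro _ ⟨e, he, rfl⟩ _ ⟨e', he', rfl⟩
    have hU : IsOpen {z : Z × V | (t z.1, z.2) ∈ e.target ∩ e.symm ⁻¹' e'.source} :=
      (e.isOpen_inter_preimage_symm e'.open_source).preimage (by fun_prop)
    have hset : (pullbackChart A t ht e he).target ∩
        (pullbackChart A t ht e he).symm ⁻¹' (pullbackChart A t ht e' he').source =
        {z : Z × V | (t z.1, z.2) ∈ e.target ∩ e.symm ⁻¹' e'.source} := by
      ext z
      refine and_congr_right fun hz => ?_
      change ((pullbackChart A t ht e he).symm z).1.2 ∈ e'.source ↔ _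
      rw [pullbackChart_symm_val A t ht e he z hz]
      rfl
    rw [hset]
    refine ((A.compat e he e' he').comp_base ht).congr hU ?_
    rintro z ⟨hz, -⟩
    change _ = (e' ((pullbackChart A t ht e he).symm z).1.2).2
    rw [pullbackChart_symm_val A t ht e he z hz]

end Families

/-! ### Groupoids and their actions -/

/-- A topological groupoid with space of arrows `G` and space of units `G₀`. The product `mul g h _`
is defined for `s g = r h`, and `G₀` carries the relative topology of the set of units in `G`. -/
structure TopGroupoid (G G₀ : Type*) [TopologicalSpace G] [TopologicalSpace G₀] where
  r : G → G₀
  s : G → G₀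
  unit : G₀ → G
  inv : G → G
  mul : ∀ g h : G, s g = r h → G
  r_unit : ∀ u, r (unit u) = u
  s_unit : ∀ u, s (unit u) = u
  r_mul : ∀ g h (w : s g = r h), r (mul g h w) = r g
  s_mul : ∀ g h (w : s g = r h), s (mul g h w) = s h
  mul_assoc : ∀ g h k (w : s g = r h) (w' : s h = r k),
    mul (mul g h w) k ((s_mul g h w).trans w') = mul g (mul h k w') (w.trans (r_mul h k w').symm)
  unit_mul : ∀ g, mul (unit (r g)) g (s_unit _) = g
  mul_unit : ∀ g, mul g (unit (s g)) (r_unit _).symm = g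
  r_inv : ∀ g, r (inv g) = s g
  s_inv : ∀ g, s (inv g) = r g
  mul_inv : ∀ g, mul g (inv g) (r_inv g).symm = unit (r g)
  inv_mul : ∀ g, mul (inv g) g (s_inv g) = unit (s g)
  isEmbedding_unit : IsEmbedding unit
  continuous_inv : Continuous inv
  continuous_mul : Continuous fun z : Pullback s r => mul z.1.1 z.1.2 z.2

namespace TopGroupoid

variable {G G₀ : Type*} [TopologicalSpace G] [TopologicalSpace G₀] (𝒢 : TopGroupoid G G₀)

theorem continuous_r : Continuous 𝒢.r := by
  rw [𝒢.isEmbedding_unit.continuous_iff]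
  have h : Continuous fun g => (⟨(g, 𝒢.inv g), (𝒢.r_inv g).symm⟩ : Pullback 𝒢.s 𝒢.r) :=
    Continuous.subtype_mk (continuous_id.prodMk 𝒢.continuous_inv) _
  exact (𝒢.continuous_mul.comp h).congr fun g => 𝒢.mul_inv g

theorem continuous_s : Continuous 𝒢.s :=
  (𝒢.continuous_r.comp 𝒢.continuous_inv).congr fun g => 𝒢.r_inv g

/-- A continuous family groupoid structure: `C^{∞,0}` structures on `(G, s)` and `(G, r)` that are
interchanged by inversion and for which multiplication, as a map from the fibred product
`{(g, h) | s g = r h}`, a continuous family over `G` via `(g, h) ↦ g`, to `(G, r)`, is a morphism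
over `r`. -/
structure ContinuousFamilyStructure (V : Type*) [NormedAddCommGroup V] [NormedSpace ℝ V] where
  famS : ContinuousFamily V 𝒢.s
  famR : ContinuousFamily V 𝒢.r
  inv_r_s : IsMorphism famR famS id 𝒢.inv
  inv_s_r : IsMorphism famS famR id 𝒢.inv
  mul : IsMorphism (famR.pullback 𝒢.s 𝒢.continuous_s) famR 𝒢.r
    (fun z => 𝒢.mul z.1.1 z.1.2 z.2)

/-- A continuous action of the groupoid on `p : X → G₀`; `g x` is defined for `s g = p x`. -/
structure Action {X : Type*} [TopologicalSpace X] (p : X → G₀) where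
  act : ∀ (g : G) (x : X), 𝒢.s g = p x → X
  p_act : ∀ g x (w : 𝒢.s g = p x), p (act g x w) = 𝒢.r g
  mul_act : ∀ g h x (w : 𝒢.s g = 𝒢.r h) (w' : 𝒢.s h = p x),
    act g (act h x w') (w.trans (p_act h x w').symm) =
      act (𝒢.mul g h w) x ((𝒢.s_mul g h w).trans w')
  inv_act : ∀ g x (w : 𝒢.s g = p x),
    act (𝒢.inv g) (act g x w) ((𝒢.s_inv g).trans (p_act g x w).symm) = x
  continuous_act : Continuous fun z : Pullback 𝒢.s p => act z.1.1 z.1.2 z.2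

variable {𝒢}

namespace Action

variable {X : Type*} [TopologicalSpace X] {p : X → G₀} (α : 𝒢.Action p)

/-- The action is proper: `(g, x) ↦ (g x, x)` is a proper map from `{(g, x) | s g = p x}` to
`X × X`. -/
def IsProper : Prop :=
  IsProperMap fun z : Pullback 𝒢.s p => (α.act z.1.1 z.1.2 z.2, z.1.2)

/-- The action makes the continuous family `(X, p)` a `C^{∞,0}` `G`-space: the action is a morphism
over `r` from the family `{(g, x) | s g = p x}` over `G` to `X`. -/
def IsCInfZero {V : Type*} [NormedAddCommGroup V] [NormedSpace ℝ V]
    (A : ContinuousFamily V p) : Prop :=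
  IsMorphism (A.pullback 𝒢.s 𝒢.continuous_s) A 𝒢.r (fun z => α.act z.1.1 z.1.2 z.2)

end Action

end TopGroupoid

/-! ### Vector bundles and hermitian metrics -/

/-- A family of (positive definite) hermitian inner products on the fibres of `E`, conjugate-linear
in the first variable. -/
structure HermitianMetric {X : Type*} (E : X → Type*) [∀ x, AddCommGroup (E x)]
    [∀ x, Module ℂ (E x)] where
  inner : ∀ x, E x →ₗ⋆[ℂ] E x →ₗ[ℂ] ℂ
  conj_symm : ∀ x v w, conj (inner x w v) = inner x v w
  pos : ∀ x v, v ≠ 0 → 0 < (inner x v v).re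

section Bundles

variable {G G₀ X V V' : Type*} [TopologicalSpace G] [TopologicalSpace G₀] [TopologicalSpace X]
  [NormedAddCommGroup V] [NormedSpace ℝ V] [NormedAddCommGroup V'] [NormedSpace ℝ V']
  {p : X → G₀} {𝒢 : TopGroupoid G G₀}
  (F : Type*) [NormedAddCommGroup F] [NormedSpace ℂ F]
  (E : X → Type*) [∀ x, AddCommGroup (E x)] [∀ x, Module ℂ (E x)]
  [∀ x, TopologicalSpace (E x)] [TopologicalSpace (TotalSpace F E)]

/-- The continuous complex vector bundle `E` over `(X, p)`, whose total space is a continuous family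
over the same parameter space with projection `p ∘ π`, is a `C^{∞,0}` vector bundle: near every
point of `X` there is a linear local trivialization `E_U ≃ U × F` which is `C^{∞,0}` in both
directions. -/
def IsCInfZeroVectorBundle (A : ContinuousFamily V p)
    (B : ContinuousFamily V' (fun ξ : TotalSpace F E => p ξ.proj)) : Prop :=
  ∀ x : X, ∃ e : Trivialization F (π F E), x ∈ e.baseSet ∧ e.IsLinear ℂ ∧
    IsMorphismOn B (A.prodModel F) id e e.source ∧
    IsMorphismOn (A.prodModel F) B id e.toOpenPartialHomeomorph.symm e.target

/-- A continuous `G`-vector bundle structure on `E` over the `G`-space `X`: the arrow `g` with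
`s g = p x` acts by a linear map from `E x` to `E (g x)`, and this defines a continuous action on
the total space. -/
structure GVectorBundle (α : 𝒢.Action p) where
  fiberAct : ∀ (g : G) (x : X) (w : 𝒢.s g = p x), E x →ₗ[ℂ] E (α.act g x w)
  mul_act : ∀ g h x (w : 𝒢.s g = 𝒢.r h) (w' : 𝒢.s h = p x) (v : E x),
    (TotalSpace.mk _ (fiberAct g (α.act h x w') (w.trans (α.p_act h x w').symm)
      (fiberAct h x w' v)) : TotalSpace F E) =
    TotalSpace.mk _ (fiberAct (𝒢.mul g h w) x ((𝒢.s_mul g h w).trans w') v)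
  inv_act : ∀ g x (w : 𝒢.s g = p x) (v : E x),
    (TotalSpace.mk _ (fiberAct (𝒢.inv g) (α.act g x w) ((𝒢.s_inv g).trans (α.p_act g x w).symm)
      (fiberAct g x w v)) : TotalSpace F E) = TotalSpace.mk x v
  continuous_act : Continuous fun z : Pullback 𝒢.s (fun ξ : TotalSpace F E => p ξ.proj) =>
    (TotalSpace.mk _ (fiberAct z.1.1 z.1.2.proj z.2 z.1.2.snd) : TotalSpace F E)

variable {F E} in
/-- The induced action of the groupoid on the total space of a `G`-vector bundle. -/
def GVectorBundle.totalAction {α : 𝒢.Action p} (β : GVectorBundle F E α) :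
    𝒢.Action (fun ξ : TotalSpace F E => p ξ.proj) where
  act g ξ w := TotalSpace.mk _ (β.fiberAct g ξ.proj w ξ.snd)
  p_act g ξ w := α.p_act g ξ.proj w
  mul_act g h ξ w w' := β.mul_act g h ξ.proj w w' ξ.snd
  inv_act g ξ w := β.inv_act g ξ.proj w ξ.snd
  continuous_act := β.continuous_act

/-- `E` is a `C^{∞,0}` `G`-vector bundle: a continuous `G`-vector bundle which is a `C^{∞,0}` vector
bundle and whose total space is a `C^{∞,0}` `G`-space. -/
structure IsCInfZeroGVectorBundle (A : ContinuousFamily V p)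
    (B : ContinuousFamily V' (fun ξ : TotalSpace F E => p ξ.proj)) {α : 𝒢.Action p}
    (β : GVectorBundle F E α) : Prop where
  vectorBundle : IsCInfZeroVectorBundle F E A B
  gSpace : β.totalAction.IsCInfZero B

/-- A `C^{∞,0}` section of `E`. -/
def IsCInfZeroSection (A : ContinuousFamily V p)
    (B : ContinuousFamily V' (fun ξ : TotalSpace F E => p ξ.proj)) (σ : ∀ x, E x) : Prop :=
  IsMorphism A B id (fun x => (TotalSpace.mk x (σ x) : TotalSpace F E))

variable {E} in
/-- The metric is `C^{∞,0}`: for all `C^{∞,0}` sections `σ`, `τ` of `E` the function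
`x ↦ γ^x(σ x, τ x)` is `C^{∞,0}`, i.e. is a morphism from `X` to `ℂ` regarded as a continuous family
over the one-point space. -/
def HermitianMetric.IsCInfZero (γ : HermitianMetric E) (A : ContinuousFamily V p)
    (B : ContinuousFamily V' (fun ξ : TotalSpace F E => p ξ.proj)) : Prop :=
  ∀ σ τ : ∀ x, E x, IsCInfZeroSection F E A B σ → IsCInfZeroSection F E A B τ →
    IsMorphism A (ContinuousFamily.point ℂ) (fun _ => ()) (fun x => γ.inner x (σ x) (τ x))

variable {F E} in
/-- The metric is `G`-isometric: `γ(g ξ, g η) = γ(ξ, η)` whenever `g ξ`, `g η` are defined, for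
`ξ`, `η` in the same fibre. -/
def HermitianMetric.IsGIsometric (γ : HermitianMetric E) {α : 𝒢.Action p}
    (β : GVectorBundle F E α) : Prop :=
  ∀ (g : G) (x : X) (w : 𝒢.s g = p x) (ξ η : E x),
    γ.inner (α.act g x w) (β.fiberAct g x w ξ) (β.fiberAct g x w η) = γ.inner x ξ η

end Bundles

end CFam

end

/-! The metric is produced by averaging. A cutoff `χ` vanishing outside a small compact set `C`,
together with a trivialization of `E` over `C`, gives a semidefinite hermitian form on `E`. Its
average at `x` is the integral of `χ(g⁻¹x) ⟨g⁻¹ξ, g⁻¹η⟩` over the arrows `g` with `r g = p x`, with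
respect to left invariant measures on the fibres of `r`. Since `(gk)⁻¹gξ = k⁻¹ξ`, left invariance of
the measures makes the average `G`-isometric (`average_actT`). Properness makes the set of arrows
with `g⁻¹x ∈ C` compact, uniformly for `x` in a compact set, so the integral exists and is of class
`C^{∞,0}` in `x` (`isSmoothAt_average`).

A Haar system on all of `G` is not needed. Left multiplication preserves sources, so the arrows
whose source, as a unit, lies in one fixed chart `e₀` form a left invariant set. There the density
at `g` in a chart `e` can be taken to be the absolute determinant of the derivative of left
translation by `g⁻¹`, read in `e` and `e₀`. As `g⁻¹ = (kg)⁻¹k`, the chain rule (`jac_eq`) and the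
change of variables formula give left invariance (`haar_translate`). The pieces in the charts are
glued by a merely continuous partition of unity: under the integral the arrow is a parameter, and
derivatives are taken only along the fibres of `X` (`isCInfZeroAt_integral`, `isCInfZeroAt_haar`).

For a proper action the orbit space is Hausdorff, locally compact and σ-compact. Hence there are
cutoffs, each small enough for the local construction, whose saturated supports of non-vanishing
form a locally finite cover of `X` (`exists_locallyFinite_isBump`). The averages of the
corresponding forms add up to an invariant form of class `C^{∞,0}`. It is positive definite because
every term is semidefinite and, at each point, some term is definite; no normalization of the
cutoffs is required. -/

set_option linter.unusedSectionVars false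

namespace CFam

/-! ### The class `C^{∞,0}` at a point -/

section Calculus

variable {T T' V V' V'' V₁ : Type*} [TopologicalSpace T] [TopologicalSpace T']
  [NormedAddCommGroup V] [NormedSpace ℝ V] [NormedAddCommGroup V'] [NormedSpace ℝ V']
  [NormedAddCommGroup V''] [NormedSpace ℝ V''] [NormedAddCommGroup V₁] [NormedSpace ℝ V₁]

/-- `f` is of class `C^{∞,0}` near `z`: for each `n`, its slices are `C^n` at all points close to
`z`, and the `n`-th derivative of the slices is jointly continuous at `z`. -/
def IsCInfZeroAt (f : T × V → V') (z : T × V) : Prop :=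
  ∀ n : ℕ, (∀ᶠ y in 𝓝 z, ContDiffAt ℝ n (fun v => f (y.1, v)) y.2) ∧
    ContinuousAt (fun y : T × V => iteratedFDeriv ℝ n (fun v => f (y.1, v)) y.2) z

theorem IsCInfZeroAt.continuousAt {f : T × V → V'} {z : T × V} (hf : IsCInfZeroAt f z) :
    ContinuousAt f z := by
  have h := (continuousMultilinearCurryFin0 ℝ V V').continuous.continuousAt.comp (hf 0).2
  refine h.congr (Eventually.of_forall fun y => ?_)
  simp

theorem IsCInfZeroAt.eventually_contDiffAt {f : T × V → V'} {z : T × V} (hf : IsCInfZeroAt f z)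
    (n : ℕ) : ∀ᶠ y in 𝓝 z, ContDiffAt ℝ n (fun v => f (y.1, v)) y.2 := (hf n).1

theorem IsCInfZeroAt.contDiffAt {f : T × V → V'} {z : T × V} (hf : IsCInfZeroAt f z)
    (n : ℕ) : ContDiffAt ℝ n (fun v => f (z.1, v)) z.2 := (hf n).1.self_of_nhds

theorem eventuallyEq_slice {T V V' : Type*} [TopologicalSpace T] [TopologicalSpace V]
    {f g : T × V → V'} {z : T × V} (h : f =ᶠ[𝓝 z] g) :
    (fun v => f (z.1, v)) =ᶠ[𝓝 z.2] fun v => g (z.1, v) :=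
  have hc : Tendsto (fun v => (z.1, v)) (𝓝 z.2) (𝓝 z) :=
    (Continuous.prodMk_right z.1).tendsto z.2
  hc.eventually h

theorem IsCInfZeroAt.congr {f g : T × V → V'} {z : T × V} (hf : IsCInfZeroAt f z)
    (h : f =ᶠ[𝓝 z] g) : IsCInfZeroAt g z := by
  have h' : ∀ᶠ y in 𝓝 z, (fun v => f (y.1, v)) =ᶠ[𝓝 y.2] fun v => g (y.1, v) :=
    h.eventuallyEq_nhds.mono fun y hy => eventuallyEq_slice hy
  refine fun n => ⟨?_, (hf n).2.congr ?_⟩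
  · filter_upwards [(hf n).1, h'] with y hy hy'
    exact hy.congr_of_eventuallyEq hy'.symm
  · filter_upwards [h'] with y hy
    exact (hy.iteratedFDeriv ℝ n).eq_of_nhds

/-- For a finite-dimensional fibre, `C^{∞,0}` on an open set is a pointwise condition. -/
theorem isCInfZeroOn_iff [FiniteDimensional ℝ V] {f : T × V → V'} {U : Set (T × V)}
    (hU : IsOpen U) : IsCInfZeroOn f U ↔ ∀ z ∈ U, IsCInfZeroAt f z := by
  have : ProperSpace V := FiniteDimensional.proper_real V
  have hopen : ∀ t, IsOpen {w | (t, w) ∈ U} := fun t => hU.preimage (Continuous.prodMk_right t)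
  constructor
  · rintro hf ⟨t₀, w₀⟩ hz n
    refine ⟨?_, ?_⟩
    · filter_upwards [hU.mem_nhds hz] with y hy
      exact (((hf.1 y.1) y.2 hy).contDiffAt ((hopen y.1).mem_nhds hy)).of_le
        (by exact_mod_cast le_top)
    · obtain ⟨K, hK, hKU, hKc⟩ := local_compact_nhds ((hopen t₀).mem_nhds hz)
      have h1 := hf.2 n t₀ K hKc fun w hw => hKU hw
      have h2 : ContinuousAt (iteratedFDeriv ℝ n fun v => f (t₀, v)) w₀ := by
        have : ContDiffAt ℝ ∞ (fun v => f (t₀, v)) w₀ :=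
          ((hf.1 t₀) w₀ hz).contDiffAt ((hopen t₀).mem_nhds hz)
        exact this.continuousAt_iteratedFDeriv (by exact_mod_cast le_top)
      rw [Metric.tendstoUniformlyOn_iff] at h1
      rw [Metric.continuousAt_iff'] at h2 ⊢
      intro ε hε
      have h3 : ∀ᶠ y : T × V in 𝓝 (t₀, w₀), _ :=
        continuousAt_fst.eventually (h1 (ε / 2) (half_pos hε))
      have h4 : ∀ᶠ y : T × V in 𝓝 (t₀, w₀), _ :=
        continuousAt_snd.eventually (h2 (ε / 2) (half_pos hε))
      have h5 : ∀ᶠ y : T × V in 𝓝 (t₀, w₀), y.2 ∈ K := continuousAt_snd.eventually hK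
      filter_upwards [h3, h4, h5] with y h3 h4 h5
      have := h3 y.2 h5
      rw [dist_comm] at this
      exact (dist_triangle _ _ _).trans_lt (by linarith)
  · intro hf
    refine ⟨fun t => ?_, fun n t₀ K hK hKU => ?_⟩
    · rw [contDiffOn_infty]
      exact fun n w hw => ((hf (t, w) hw).contDiffAt n).contDiffWithinAt
    · rw [Metric.tendstoUniformlyOn_iff]
      intro ε hε
      -- Compactness of `K` reduces uniform closeness to a joint neighbourhood of each `(t₀, w)`;
      -- there the slices over `t` and over `t₀` are both compared with the value at `(t₀, w)`.
      refine hK.eventually_forall_of_forall_eventually fun w hw => ?_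
      have h1 := (Metric.continuousAt_iff'.1 (hf (t₀, w) (hKU w hw) n).2) (ε / 2) (half_pos hε)
      have hc : Tendsto (fun y : T × V => (t₀, y.2)) (𝓝 (t₀, w)) (𝓝 (t₀, w)) :=
        (by fun_prop : Continuous fun y : T × V => (t₀, y.2)).tendsto (t₀, w)
      have h2 := hc.eventually h1
      filter_upwards [h1, h2] with y h1 h2
      rw [dist_comm] at h1
      exact (dist_triangle _ _ _).trans_lt (by linarith)

/-- By Faà di Bruno's formula, the derivatives of the composite are finite sums of continuous
multilinear expressions in the derivatives of the two factors, so joint continuity is inherited. -/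
theorem IsCInfZeroAt.comp {f₂ : T' × V' → V''} {q : T → T'} {f₁ : T × V → V'} {z : T × V}
    (h₂ : IsCInfZeroAt f₂ (q z.1, f₁ z)) (hq : ContinuousAt q z.1) (h₁ : IsCInfZeroAt f₁ z) :
    IsCInfZeroAt (fun y => f₂ (q y.1, f₁ y)) z := by
  have hc : ContinuousAt (fun y : T × V => (q y.1, f₁ y)) z :=
    (hq.comp (x := z) continuousAt_fst).prodMk h₁.continuousAt
  have ev := fun n => (h₁.eventually_contDiffAt n).and (hc.eventually (h₂.eventually_contDiffAt n))
  refine fun n => ⟨?_, ?_⟩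
  · filter_upwards [ev n] with y hy
    exact ContDiffAt.comp (g := fun v => f₂ (q y.1, v)) y.2 hy.2 hy.1
  · have key : (fun y : T × V => ∑ c : OrderedFinpartition n,
        (c.compAlongOrderedFinpartitionL ℝ V V' V''
          (iteratedFDeriv ℝ c.length (fun v => f₂ (q y.1, v)) (f₁ y)))
          fun i => iteratedFDeriv ℝ (c.partSize i) (fun v => f₁ (y.1, v)) y.2) =ᶠ[𝓝 z]
        fun y => iteratedFDeriv ℝ n (fun v => f₂ (q y.1, f₁ (y.1, v))) y.2 := by
      filter_upwards [ev n] with y hy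
      exact (iteratedFDeriv_comp (g := fun v => f₂ (q y.1, v))
        (f := fun v => f₁ (y.1, v)) hy.2 hy.1 le_rfl).symm
    refine ContinuousAt.congr ?_ key
    refine tendsto_finsetSum _ fun c _ => ?_
    have hB := (c.compAlongOrderedFinpartitionL ℝ V V' V'').continuous_uncurry_of_multilinear
    refine hB.continuousAt.comp (f := fun y : T × V =>
      ((iteratedFDeriv ℝ c.length (fun v => f₂ (q y.1, v)) (f₁ y)),
        fun i => iteratedFDeriv ℝ (c.partSize i) (fun v => f₁ (y.1, v)) y.2)) ?_
    refine ContinuousAt.prodMk ?_ (continuousAt_pi.2 fun i => (h₁ _).2)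
    exact ContinuousAt.comp (f := fun y : T × V => (q y.1, f₁ y))
      (g := fun y : T' × V' => iteratedFDeriv ℝ c.length (fun v => f₂ (y.1, v)) y.2)
      (h₂ c.length).2 hc

theorem IsCInfZeroAt.prodMk {f : T × V → V'} {g : T × V → V''} {z : T × V}
    (hf : IsCInfZeroAt f z) (hg : IsCInfZeroAt g z) : IsCInfZeroAt (fun y => (f y, g y)) z := by
  refine fun n => ⟨?_, ?_⟩
  · filter_upwards [(hf n).1, (hg n).1] with y h1 h2 using h1.prodMk h2
  · have key : (fun y : T × V => (iteratedFDeriv ℝ n (fun v => f (y.1, v)) y.2).prod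
        (iteratedFDeriv ℝ n (fun v => g (y.1, v)) y.2)) =ᶠ[𝓝 z]
        fun y => iteratedFDeriv ℝ n (fun v => (f (y.1, v), g (y.1, v))) y.2 := by
      filter_upwards [(hf n).1, (hg n).1] with y h1 h2
      exact (iteratedFDeriv_prodMk h1 h2 le_rfl).symm
    refine ContinuousAt.congr ?_ key
    exact (ContinuousMultilinearMap.prodL ℝ (fun _ : Fin n => V) V' V'').continuous.continuousAt.comp
      ((hf n).2.prodMk (hg n).2)

theorem isCInfZeroAt_of_contDiff {c : V → V'} (hc : ContDiff ℝ ∞ c) (z : T × V) :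
    IsCInfZeroAt (fun y : T × V => c y.2) z := fun n =>
  ⟨Eventually.of_forall fun _ => (hc.of_le (by exact_mod_cast le_top)).contDiffAt,
    (hc.continuous_iteratedFDeriv (by exact_mod_cast le_top)).continuousAt.comp continuousAt_snd⟩

/-- The slices are constant, so their derivatives of positive order vanish. This is how densities
and partition functions, known only to be continuous in the arrow, enter the calculus. -/
theorem isCInfZeroAt_of_continuousAt {a : T → V'} {z : T × V} (ha : ContinuousAt a z.1) :
    IsCInfZeroAt (fun y : T × V => a y.1) z := by
  refine fun n => ⟨Eventually.of_forall fun y => contDiffAt_const (c := a y.1), ?_⟩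
  rcases n with _ | n
  · have : ContinuousAt (fun y : T × V => (continuousMultilinearCurryFin0 ℝ V V').symm (a y.1)) z :=
      (continuousMultilinearCurryFin0 ℝ V V').symm.continuous.continuousAt.comp
        (ha.comp (x := z) continuousAt_fst)
    refine this.congr (Eventually.of_forall fun y => ?_)
    ext m
    simp
  · simp only [iteratedFDeriv_succ_const]
    exact continuousAt_const

theorem IsCInfZeroAt.contDiff_comp {f : T × V → V'} {z : T × V} {c : V' → V''}
    (hc : ContDiff ℝ ∞ c) (hf : IsCInfZeroAt f z) : IsCInfZeroAt (fun y => c (f y)) z :=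
  (isCInfZeroAt_of_contDiff hc (z.1, f z)).comp continuousAt_id hf

theorem IsCInfZeroAt.comp_base {f : T' × V → V'} {q : T → T'} {z : T × V}
    (hf : IsCInfZeroAt f (q z.1, z.2)) (hq : ContinuousAt q z.1) :
    IsCInfZeroAt (fun y => f (q y.1, y.2)) z :=
  IsCInfZeroAt.comp (f₁ := Prod.snd) hf hq (isCInfZeroAt_of_contDiff contDiff_id z)

theorem IsCInfZeroAt.add {f g : T × V → V'} {z : T × V}
    (hf : IsCInfZeroAt f z) (hg : IsCInfZeroAt g z) : IsCInfZeroAt (fun y => f y + g y) z :=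
  (hf.prodMk hg).contDiff_comp (c := fun p : V' × V' => p.1 + p.2) (by fun_prop)

theorem IsCInfZeroAt.smul {f : T × V → ℝ} {g : T × V → V'} {z : T × V}
    (hf : IsCInfZeroAt f z) (hg : IsCInfZeroAt g z) : IsCInfZeroAt (fun y => f y • g y) z :=
  (hf.prodMk hg).contDiff_comp (c := fun p : ℝ × V' => p.1 • p.2) (by fun_prop)

theorem isCInfZeroAt_sum {ι : Type*} {f : ι → T × V → V'} {z : T × V} (s : Finset ι)
    (hf : ∀ i ∈ s, IsCInfZeroAt (f i) z) : IsCInfZeroAt (fun y => ∑ i ∈ s, f i y) z := by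
  classical
  induction s using Finset.induction_on with
  | empty => simpa using isCInfZeroAt_of_continuousAt (a := fun _ : T => (0 : V')) continuousAt_const
  | insert i s hi ih =>
    simp only [Finset.sum_insert hi]
    exact (hf i (Finset.mem_insert_self i s)).add
      (ih fun j hj => hf j (Finset.mem_insert_of_mem hj))

theorem IsCInfZeroAt.continuousAt_fderiv {f : T × V → V'} {z : T × V} (hf : IsCInfZeroAt f z) :
    ContinuousAt (fun y : T × V => fderiv ℝ (fun v => f (y.1, v)) y.2) z := by
  have h := (continuousMultilinearCurryFin1 ℝ V V').continuous.continuousAt.comp (hf 1).2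
  refine h.congr (Eventually.of_forall fun y => ?_)
  ext v
  simp [iteratedFDeriv_one_apply]

theorem IsCInfZeroAt.hasFDerivAt {f : T × V → V'} {z : T × V} (hf : IsCInfZeroAt f z) :
    HasFDerivAt (fun v => f (z.1, v)) (fderiv ℝ (fun v => f (z.1, v)) z.2) z.2 :=
  ((hf.contDiffAt 1).differentiableAt (by simp)).hasFDerivAt

end Calculus

/-! ### Integrals depending on parameters -/

section ParametricIntegral

open MeasureTheory

variable {T Y W E' : Type*} [TopologicalSpace T] [TopologicalSpace Y] [MeasurableSpace Y]
  [OpensMeasurableSpace Y] [T2Space Y] {μ : Measure Y} [IsFiniteMeasureOnCompacts μ]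
  [NormedAddCommGroup W] [NormedSpace ℝ W] [FiniteDimensional ℝ W]
  [NormedAddCommGroup E'] [NormedSpace ℝ E']
  {b : (T × Y) × W → E'} {Ω : Set (T × W)} {k : Set Y}

theorem iteratedFDeriv_slice_eq_zero (hΩ : IsOpen Ω)
    (hbk : ∀ t w, (t, w) ∈ Ω → ∀ y ∉ k, b ((t, y), w) = 0) {z : T × W} (hz : z ∈ Ω) {y : Y}
    (hy : y ∉ k) (n : ℕ) : iteratedFDeriv ℝ n (fun v => b ((z.1, y), v)) z.2 = 0 := by
  have h : (fun v => b ((z.1, y), v)) =ᶠ[𝓝 z.2] fun _ => 0 := by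
    filter_upwards [(hΩ.preimage (Continuous.prodMk_right z.1)).mem_nhds hz] with v hv
    exact hbk _ _ hv y hy
  rw [(h.iteratedFDeriv ℝ n).eq_of_nhds]
  exact congrFun iteratedFDeriv_fun_zero z.2

theorem continuousOn_iteratedFDeriv_slice
    (hb : ∀ t w, (t, w) ∈ Ω → ∀ y, IsCInfZeroAt b ((t, y), w)) (n : ℕ) :
    ContinuousOn (Function.uncurry fun (z : T × W) (y : Y) =>
      iteratedFDeriv ℝ n (fun v => b ((z.1, y), v)) z.2) (Ω ×ˢ univ) := by
  rintro ⟨⟨t, w⟩, y⟩ ⟨hz, -⟩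
  have h := (hb t w hz y n).2
  have hc : ContinuousAt (fun x : (T × W) × Y => ((x.1.1, x.2), x.1.2)) ((t, w), y) := by fun_prop
  exact (ContinuousAt.comp (f := fun x : (T × W) × Y => ((x.1.1, x.2), x.1.2))
    (g := fun x : (T × Y) × W => iteratedFDeriv ℝ n (fun v => b (x.1, v)) x.2)
    (x := ((t, w), y)) h hc).continuousWithinAt

theorem continuousOn_integral_iteratedFDeriv_slice (hΩ : IsOpen Ω) (hk : IsCompact k)
    (hb : ∀ t w, (t, w) ∈ Ω → ∀ y, IsCInfZeroAt b ((t, y), w))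
    (hbk : ∀ t w, (t, w) ∈ Ω → ∀ y ∉ k, b ((t, y), w) = 0) (n : ℕ) :
    ContinuousOn (fun z : T × W => ∫ y, iteratedFDeriv ℝ n (fun v => b ((z.1, y), v)) z.2 ∂μ) Ω :=
  continuousOn_integral_of_compact_support hk (continuousOn_iteratedFDeriv_slice hb n)
    fun _ _ hz hy => iteratedFDeriv_slice_eq_zero hΩ hbk hz hy n

/-- Differentiation under the integral sign for compactly supported continuous integrands. -/
theorem hasFDerivAt_integral_of_compact_support {E₁ E₂ : Type*} [NormedAddCommGroup E₁]
    [NormedSpace ℝ E₁] [NormedAddCommGroup E₂] [NormedSpace ℝ E₂] (J : E₂ ≃ₗᵢ[ℝ] (W →L[ℝ] E₁))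
    {U : Set W} (hU : IsOpen U) (hk : IsCompact k) {F : W → Y → E₁} {F' : W → Y → E₂}
    (hF : ContinuousOn (Function.uncurry F) (U ×ˢ univ))
    (hF' : ContinuousOn (Function.uncurry F') (U ×ˢ univ))
    (hFk : ∀ w ∈ U, ∀ y ∉ k, F w y = 0) (hFk' : ∀ w ∈ U, ∀ y ∉ k, F' w y = 0)
    (hd : ∀ w ∈ U, ∀ y, HasFDerivAt (fun w => F w y) (J (F' w y)) w) {w : W} (hw : w ∈ U) :
    HasFDerivAt (fun w => ∫ y, F w y ∂μ) (J (∫ y, F' w y ∂μ)) w := by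
  have : ProperSpace W := FiniteDimensional.proper_real W
  have hint : ∀ w' ∈ U, Integrable (F w') μ := fun w' hw' =>
    (hF.comp_continuous (f := fun y => (w', y)) (by fun_prop)
      fun y => ⟨hw', mem_univ _⟩).integrable_of_hasCompactSupport
        (HasCompactSupport.intro hk (hFk w' hw'))
  have hint' : Integrable (F' w) μ :=
    (hF'.comp_continuous (f := fun y => (w, y)) (by fun_prop)
      fun y => ⟨hw, mem_univ _⟩).integrable_of_hasCompactSupport
        (HasCompactSupport.intro hk (hFk' w hw))
  obtain ⟨s, hs, hsU, hsc⟩ := local_compact_nhds (hU.mem_nhds hw)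
  -- The dominating function is the constant `C` on the compact set `k` and zero elsewhere; it is
  -- valid for base points in the compact neighbourhood `s`.
  obtain ⟨C, hC⟩ := (hsc.prod hk).exists_bound_of_continuousOn
    (hF'.mono (prod_mono hsU (subset_univ k)))
  have key := hasFDerivAt_integral_of_dominated_of_fderiv_le (𝕜 := ℝ) (μ := μ) (x₀ := w) (s := s)
    (F := F) (F' := fun w y => J (F' w y)) (bound := k.indicator fun _ => C) hs ?_ (hint w hw)
    ?_ ?_ ?_ ?_
  · exact key.congr_fderiv (J.toContinuousLinearEquiv.integral_comp_comm (μ := μ) (F' w))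
  · filter_upwards [hs] with w' hw'
    exact (hint w' (hsU hw')).aestronglyMeasurable
  · exact (J.toContinuousLinearEquiv.toContinuousLinearMap.integrable_comp
      hint').aestronglyMeasurable
  · refine Eventually.of_forall fun y w' hw' => ?_
    rw [J.norm_map]
    by_cases hy : y ∈ k
    · rw [indicator_of_mem hy]
      exact hC (w', y) ⟨hw', hy⟩
    · rw [indicator_of_notMem hy, hFk' _ (hsU hw') y hy, norm_zero]
  · rw [integrable_indicator_iff hk.measurableSet]
    exact integrableOn_const hk.measure_ne_top
  · exact Eventually.of_forall fun y w' hw' => hd w' (hsU hw') y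

/-- The inductive step for higher derivatives of the integral. Currying is an isometry, which lets
the derivative of the `n`-th term be integrated in the space of `(n + 1)`-linear maps. -/
theorem hasFDerivAt_integral_iteratedFDeriv_slice (hΩ : IsOpen Ω) (hk : IsCompact k)
    (hb : ∀ t w, (t, w) ∈ Ω → ∀ y, IsCInfZeroAt b ((t, y), w))
    (hbk : ∀ t w, (t, w) ∈ Ω → ∀ y ∉ k, b ((t, y), w) = 0) (n : ℕ) {t : T} {w : W}
    (hz : (t, w) ∈ Ω) :
    HasFDerivAt (fun w => ∫ y, iteratedFDeriv ℝ n (fun v => b ((t, y), v)) w ∂μ)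
      (∫ y, iteratedFDeriv ℝ (n + 1) (fun v => b ((t, y), v)) w ∂μ).curryLeft w := by
  have hΩt : IsOpen {w | (t, w) ∈ Ω} := hΩ.preimage (Continuous.prodMk_right t)
  have hcont : ∀ m, ContinuousOn (Function.uncurry fun w y =>
      iteratedFDeriv ℝ m (fun v => b ((t, y), v)) w) ({w | (t, w) ∈ Ω} ×ˢ univ) := fun m =>
    (continuousOn_iteratedFDeriv_slice hb m).comp
      (f := fun x : W × Y => ((t, x.1), x.2)) (by fun_prop) fun x hx => ⟨hx.1, mem_univ _⟩
  have hsupp : ∀ m, ∀ w', (t, w') ∈ Ω → ∀ y ∉ k,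
      iteratedFDeriv ℝ m (fun v => b ((t, y), v)) w' = 0 := fun m w' hw' y hy =>
    iteratedFDeriv_slice_eq_zero (z := (t, w')) hΩ hbk hw' hy m
  refine hasFDerivAt_integral_of_compact_support
    (continuousMultilinearCurryLeftEquiv ℝ (fun _ : Fin (n + 1) => W) E') hΩt hk
    (hcont n) (hcont (n + 1)) (hsupp n) (hsupp (n + 1)) (fun w' hw' y => ?_) hz
  have h2 : DifferentiableAt ℝ (iteratedFDeriv ℝ n fun v => b ((t, y), v)) w' :=
    ((hb t w' hw' y).contDiffAt (n + 1)).differentiableAt_iteratedFDeriv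
      (by exact_mod_cast Nat.lt_succ_self n)
  exact h2.hasFDerivAt

/-- An integral of a compactly supported family of functions of class `C^{∞,0}` is of class
`C^{∞,0}`. -/
theorem isCInfZeroAt_integral (hΩ : IsOpen Ω) (hk : IsCompact k)
    (hb : ∀ t w, (t, w) ∈ Ω → ∀ y, IsCInfZeroAt b ((t, y), w))
    (hbk : ∀ t w, (t, w) ∈ Ω → ∀ y ∉ k, b ((t, y), w) = 0) {z : T × W} (hz : z ∈ Ω) :
    IsCInfZeroAt (fun x : T × W => ∫ y, b ((x.1, y), x.2) ∂μ) z := by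
  have hΩt : ∀ t, IsOpen {w | (t, w) ∈ Ω} := fun t => hΩ.preimage (Continuous.prodMk_right t)
  -- The integrated derivatives form a Taylor series on each slice. Uniqueness of such series on
  -- open sets identifies them with the derivatives of the integral, so their joint continuity
  -- suffices.
  have hT : ∀ t, HasFTaylorSeriesUpToOn ∞ (fun w => ∫ y, b ((t, y), w) ∂μ)
      (fun w n => ∫ y, iteratedFDeriv ℝ n (fun v => b ((t, y), v)) w ∂μ) {w | (t, w) ∈ Ω} := by
    intro t
    refine ⟨fun w hw => ?_, fun m _ w hw => ?_, fun m _ => ?_⟩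
    · have h2 := (continuousMultilinearCurryFin0 ℝ W E').toContinuousLinearEquiv.integral_comp_comm
        (μ := μ) (fun y => iteratedFDeriv ℝ 0 (fun v => b ((t, y), v)) w)
      refine h2.symm.trans (integral_congr_ae (Eventually.of_forall fun y => ?_))
      simp
    · exact (hasFDerivAt_integral_iteratedFDeriv_slice hΩ hk hb hbk m hw).hasFDerivWithinAt
    · exact (continuousOn_integral_iteratedFDeriv_slice hΩ hk hb hbk m).comp
        (f := fun w => (t, w)) (by fun_prop) fun w hw => hw
  refine fun n => ⟨?_, ?_⟩
  · filter_upwards [hΩ.mem_nhds hz] with y hy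
    exact ((hT y.1).contDiffOn.contDiffAt ((hΩt y.1).mem_nhds hy)).of_le
      (by exact_mod_cast le_top)
  · have h1 := (continuousOn_integral_iteratedFDeriv_slice (μ := μ) hΩ hk hb hbk n).continuousAt
      (hΩ.mem_nhds hz)
    refine h1.congr ?_
    filter_upwards [hΩ.mem_nhds hz] with y hy
    have h2 := (hT y.1).eq_iteratedFDerivWithin_of_uniqueDiffOn (m := n)
      (by exact_mod_cast le_top) (hΩt y.1).uniqueDiffOn hy
    rw [iteratedFDerivWithin_of_isOpen n (hΩt y.1) hy] at h2
    exact h2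

end ParametricIntegral

/-! ### Morphisms at a point -/

section Morphisms

variable {T₁ T₂ X₁ X₂ V₁ V₂ : Type*} [TopologicalSpace T₁] [TopologicalSpace T₂]
  [TopologicalSpace X₁] [TopologicalSpace X₂]
  [NormedAddCommGroup V₁] [NormedSpace ℝ V₁] [FiniteDimensional ℝ V₁]
  [NormedAddCommGroup V₂] [NormedSpace ℝ V₂] {p₁ : X₁ → T₁} {p₂ : X₂ → T₂}
  {A₁ : ContinuousFamily V₁ p₁} {A₂ : ContinuousFamily V₂ p₂}

theorem IsMorphismOn.isCInfZeroAt {q : T₁ → T₂} {f : X₁ → X₂} {S : Set X₁}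
    (hf : IsMorphismOn A₁ A₂ q f S) (hS : IsOpen S) {e₁ : OpenPartialHomeomorph X₁ (T₁ × V₁)}
    (he₁ : e₁ ∈ A₁.atlas) {e₂ : OpenPartialHomeomorph X₂ (T₂ × V₂)} (he₂ : e₂ ∈ A₂.atlas)
    {z : T₁ × V₁} (hz : z ∈ e₁.target) (hzS : e₁.symm z ∈ S) (hz₂ : f (e₁.symm z) ∈ e₂.source) :
    IsCInfZeroAt (fun z => (e₂ (f (e₁.symm z))).2) z := by
  have hU : IsOpen (e₁.target ∩ e₁.symm ⁻¹' (S ∩ f ⁻¹' e₂.source)) :=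
    e₁.isOpen_inter_preimage_symm (hf.continuousOn.isOpen_inter_preimage hS e₂.open_source)
  exact (isCInfZeroOn_iff hU).1 (hf.local_form e₁ he₁ e₂ he₂) z ⟨hz, hzS, hz₂⟩

variable (A₁) in
theorem ContinuousFamily.p_symm {e : OpenPartialHomeomorph X₁ (T₁ × V₁)} (he : e ∈ A₁.atlas)
    {z : T₁ × V₁} (hz : z ∈ e.target) : p₁ (e.symm z) = z.1 := by
  rw [← A₁.chart_fst e he _ (e.map_target hz), e.right_inv hz]

variable (A₁) in
theorem ContinuousFamily.chart_eq {e : OpenPartialHomeomorph X₁ (T₁ × V₁)} (he : e ∈ A₁.atlas)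
    {x : X₁} (hx : x ∈ e.source) : (p₁ x, (e x).2) = e x :=
  Prod.ext (A₁.chart_fst e he x hx).symm rfl

variable (A₁) in
theorem ContinuousFamily.symm_chart {e : OpenPartialHomeomorph X₁ (T₁ × V₁)} (he : e ∈ A₁.atlas)
    {x : X₁} (hx : x ∈ e.source) : e.symm (p₁ x, (e x).2) = x := by
  rw [A₁.chart_eq he hx, e.left_inv hx]

end Morphisms

/-! ### Groupoid actions as total functions, and left multiplication as an action -/

namespace TopGroupoid

variable {G G₀ : Type*} [TopologicalSpace G] [TopologicalSpace G₀] {𝒢 : TopGroupoid G G₀}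

namespace Action

variable {X : Type*} [TopologicalSpace X] {p : X → G₀} (α : 𝒢.Action p)

open Classical in
/-- The action, extended to all pairs by `(g, x) ↦ x` where `g x` is not defined. -/
noncomputable def actT (g : G) (x : X) : X := if h : 𝒢.s g = p x then α.act g x h else x

variable {α}

theorem actT_eq {g : G} {x : X} (h : 𝒢.s g = p x) : α.actT g x = α.act g x h := dif_pos h

theorem p_actT {g : G} {x : X} (h : 𝒢.s g = p x) : p (α.actT g x) = 𝒢.r g := by
  rw [actT_eq h, α.p_act]

theorem inv_actT {g : G} {x : X} (h : 𝒢.s g = p x) : α.actT (𝒢.inv g) (α.actT g x) = x := by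
  rw [actT_eq (x := α.actT g x) ((𝒢.s_inv g).trans (p_actT h).symm)]
  simp only [actT_eq h]
  exact α.inv_act g x h

theorem act_mul_eq {g h : G} {x : X} (w : 𝒢.s g = 𝒢.r h) (w' : 𝒢.s h = p x) :
    α.actT (𝒢.mul g h w) x = α.actT g (α.actT h x) := by
  rw [actT_eq ((𝒢.s_mul g h w).trans w'), ← α.mul_act g h x w w', ← actT_eq]
  simp only [actT_eq w']

theorem unit_actT (x : X) : α.actT (𝒢.unit (p x)) x = x := by
  have h1 : 𝒢.s (𝒢.unit (p x)) = p x := 𝒢.s_unit _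
  have h2 := inv_actT (α := α) h1
  rw [← act_mul_eq (𝒢.s_inv _) h1, 𝒢.inv_mul, 𝒢.s_unit] at h2
  exact h2

theorem actT_inv {g : G} {x : X} (h : 𝒢.r g = p x) : α.actT g (α.actT (𝒢.inv g) x) = x := by
  have h1 : 𝒢.s (𝒢.inv g) = p x := (𝒢.s_inv g).trans h
  rw [← act_mul_eq (𝒢.r_inv g).symm h1, 𝒢.mul_inv, h, unit_actT]

/-- The cancellation behind all invariance below. For left multiplication it gives the
transformation rule of the density `jac`; for the action on `E` it gives the invariance of the
averaged form. -/
theorem inv_mul_actT {g k : G} {x : X} (w : 𝒢.s g = 𝒢.r k) (h : 𝒢.r k = p x) :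
    α.actT (𝒢.inv (𝒢.mul g k w)) (α.actT g x) = α.actT (𝒢.inv k) x := by
  have h1 : p (α.actT (𝒢.inv k) x) = 𝒢.s k := by
    rw [p_actT ((𝒢.s_inv k).trans h), 𝒢.r_inv]
  conv_lhs => rw [← actT_inv (α := α) h, ← act_mul_eq w h1.symm]
  exact inv_actT ((𝒢.s_mul g k w).trans h1.symm)

variable (α) in
theorem continuousOn_actT :
    ContinuousOn (fun z : G × X => α.actT z.1 z.2) {z | 𝒢.s z.1 = p z.2} := by
  rw [continuousOn_iff_continuous_domRestrict]
  exact α.continuous_act.congr fun z => (actT_eq z.2).symm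

/-- In the pull-back chart induced by `e` the pair `(g, x)` has coordinates `(g, w)`, so the
morphism property of the action becomes a statement on `G × V`, with the arrow as parameter. -/
theorem isCInfZeroAt_actT {V : Type*} [NormedAddCommGroup V] [NormedSpace ℝ V]
    [FiniteDimensional ℝ V] {A : ContinuousFamily V p} (hα : α.IsCInfZero A)
    {e : OpenPartialHomeomorph X (G₀ × V)} (he : e ∈ A.atlas)
    {e' : OpenPartialHomeomorph X (G₀ × V)} (he' : e' ∈ A.atlas) {z : G × V}
    (hz : (𝒢.s z.1, z.2) ∈ e.target) (hz' : α.actT z.1 (e.symm (𝒢.s z.1, z.2)) ∈ e'.source) :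
    IsCInfZeroAt (fun z : G × V => (e' (α.actT z.1 (e.symm (𝒢.s z.1, z.2)))).2) z := by
  set ê := pullbackChart A 𝒢.s 𝒢.continuous_s e he with hê
  have key : ∀ y : G × V, (𝒢.s y.1, y.2) ∈ e.target →
      α.act (ê.symm y).1.1 (ê.symm y).1.2 (ê.symm y).2 =
        α.actT y.1 (e.symm (𝒢.s y.1, y.2)) := by
    intro y hy
    have h := pullbackChart_symm_val A 𝒢.s 𝒢.continuous_s e he y hy
    rw [← actT_eq]
    change α.actT (ê.symm y).1.1 (ê.symm y).1.2 = _
    rw [hê, h]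
  have h1 := IsMorphismOn.isCInfZeroAt hα isOpen_univ (e₁ := ê) ⟨e, he, rfl⟩ he' (z := z) hz
    (mem_univ _) (by rw [key z hz]; exact hz')
  refine h1.congr ?_
  have hev : ∀ᶠ y : G × V in 𝓝 z, (𝒢.s y.1, y.2) ∈ e.target :=
    (ê.open_target).mem_nhds hz
  filter_upwards [hev] with y hy
  rw [key y hy]

end Action

variable (𝒢) in
/-- Left multiplication, as an action of the groupoid on `r : G → G₀`. -/
def leftMul : 𝒢.Action 𝒢.r where
  act := 𝒢.mul
  p_act := 𝒢.r_mul
  mul_act g h k w w' := (𝒢.mul_assoc g h k w w').symm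
  inv_act g x w := by
    -- The composability proof depends on the left factor, which is therefore generalized before
    -- being replaced by a unit.
    have key : ∀ k (hk : 𝒢.s k = 𝒢.r x), k = 𝒢.unit (𝒢.r x) → 𝒢.mul k x hk = x := by
      rintro _ _ rfl
      exact 𝒢.unit_mul x
    rw [← 𝒢.mul_assoc (𝒢.inv g) g x (𝒢.s_inv g) w]
    exact key _ _ (by rw [𝒢.inv_mul, w])
  continuous_act := 𝒢.continuous_mul

theorem leftMul_actT {g h : G} (w : 𝒢.s g = 𝒢.r h) : 𝒢.leftMul.actT g h = 𝒢.mul g h w :=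
  Action.actT_eq w

theorem s_leftMul {g h : G} (w : 𝒢.s g = 𝒢.r h) : 𝒢.s (𝒢.leftMul.actT g h) = 𝒢.s h := by
  rw [leftMul_actT w, 𝒢.s_mul]

theorem inv_leftMul_self (g : G) : 𝒢.leftMul.actT (𝒢.inv g) g = 𝒢.unit (𝒢.s g) := by
  rw [leftMul_actT (𝒢.s_inv g), 𝒢.inv_mul]

open MeasureTheory

/-! ### Left translations in charts -/

section Translate

variable {G G₀ V : Type*} [TopologicalSpace G] [TopologicalSpace G₀] {𝒢 : TopGroupoid G G₀}
  [NormedAddCommGroup V] [NormedSpace ℝ V] [FiniteDimensional ℝ V] {R : ContinuousFamily V 𝒢.r}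
  {e e' e₀ : OpenPartialHomeomorph G (G₀ × V)}

variable (𝒢) in
/-- Left translation by `k`, in the charts `e` and `e'`. -/
noncomputable def translate (e e' : OpenPartialHomeomorph G (G₀ × V)) (k : G) (w : V) : V :=
  (e' (𝒢.leftMul.actT k (e.symm (𝒢.s k, w)))).2

variable (𝒢) in
/-- The domain of left translation by `k` in the charts `e` and `e'`. -/
def translateDomain (e e' : OpenPartialHomeomorph G (G₀ × V)) (k : G) : Set V :=
  {w | (𝒢.s k, w) ∈ e.target ∧ 𝒢.leftMul.actT k (e.symm (𝒢.s k, w)) ∈ e'.source}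

variable (𝒢) in
/-- The arrows whose source is, as a unit, in the domain of the chart `e₀`. -/
def sourceDomain (e₀ : OpenPartialHomeomorph G (G₀ × V)) : Set G :=
  {g | 𝒢.unit (𝒢.s g) ∈ e₀.source}

variable (𝒢) in
/-- The density, in the chart `e`, of the left invariant measures on the fibres of `r` which at the
units in the domain of the chart `e₀` have density one in this chart. -/
noncomputable def jac (e₀ e : OpenPartialHomeomorph G (G₀ × V)) (g : G) : ℝ :=
  |(fderiv ℝ (𝒢.translate e e₀ (𝒢.inv g)) (e g).2).det|

theorem isCInfZeroAt_translate (hR : 𝒢.leftMul.IsCInfZero R) (he : e ∈ R.atlas)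
    (he' : e' ∈ R.atlas) {k : G} {w : V} (hw : w ∈ 𝒢.translateDomain e e' k) :
    IsCInfZeroAt (fun z : G × V => 𝒢.translate e e' z.1 z.2) (k, w) :=
  Action.isCInfZeroAt_actT hR he he' (z := (k, w)) hw.1 hw.2

theorem hasFDerivAt_translate (hR : 𝒢.leftMul.IsCInfZero R) (he : e ∈ R.atlas)
    (he' : e' ∈ R.atlas) {k : G} {w : V} (hw : w ∈ 𝒢.translateDomain e e' k) :
    HasFDerivAt (𝒢.translate e e' k) (fderiv ℝ (𝒢.translate e e' k) w) w :=
  (isCInfZeroAt_translate hR he he' hw).hasFDerivAt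

theorem r_symm (he : e ∈ R.atlas) {z : G₀ × V} (hz : z ∈ e.target) : 𝒢.r (e.symm z) = z.1 :=
  R.p_symm he hz

theorem chart_mem_translateDomain (he : e ∈ R.atlas) {k g : G} (w : 𝒢.s k = 𝒢.r g)
    (hg : g ∈ e.source) (hkg : 𝒢.leftMul.actT k g ∈ e'.source) :
    (e g).2 ∈ 𝒢.translateDomain e e' k := by
  constructor
  · rw [w, R.chart_eq he hg]
    exact e.map_source hg
  · rwa [w, R.symm_chart he hg]

theorem isOpen_translateDomain (he : e ∈ R.atlas) (k : G) :
    IsOpen (𝒢.translateDomain e e' k) := by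
  have h1 : ContinuousOn (fun w : V => 𝒢.leftMul.actT k (e.symm (𝒢.s k, w)))
      {w | (𝒢.s k, w) ∈ e.target} := by
    refine 𝒢.leftMul.continuousOn_actT.comp (f := fun w : V => (k, e.symm (𝒢.s k, w))) ?_ ?_
    · exact continuousOn_const.prodMk (e.continuousOn_symm.comp (by fun_prop) fun w hw => hw)
    · exact fun w hw => (r_symm he hw).symm
  exact h1.isOpen_inter_preimage (e.open_target.preimage (Continuous.prodMk_right _)) e'.open_source

/-- A point of the domain of a translation, moved by the translation. -/
theorem symm_translate (he : e ∈ R.atlas) (he' : e' ∈ R.atlas) {k : G} {w : V}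
    (hw : w ∈ 𝒢.translateDomain e e' k) :
    e'.symm (𝒢.r k, 𝒢.translate e e' k w) = 𝒢.leftMul.actT k (e.symm (𝒢.s k, w)) := by
  have h := R.symm_chart he' hw.2
  rwa [Action.p_actT (r_symm he hw.1).symm] at h

theorem translate_mem (he : e ∈ R.atlas) (he' : e' ∈ R.atlas) {k : G} {w : V}
    (hw : w ∈ 𝒢.translateDomain e e' k) :
    𝒢.translate e e' k w ∈ 𝒢.translateDomain e' e (𝒢.inv k) := by
  have hr := (r_symm he hw.1).symm
  have h1 : 𝒢.r (𝒢.leftMul.actT k (e.symm (𝒢.s k, w))) = 𝒢.r k := Action.p_actT hr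
  refine ⟨?_, ?_⟩
  · rw [𝒢.s_inv, ← h1]
    exact (R.chart_eq he' hw.2).symm ▸ e'.map_source hw.2
  · rw [𝒢.s_inv, symm_translate he he' hw, Action.inv_actT hr]
    exact e.map_target hw.1

theorem translate_inv_translate (he : e ∈ R.atlas) (he' : e' ∈ R.atlas) {k : G} {w : V}
    (hw : w ∈ 𝒢.translateDomain e e' k) :
    𝒢.translate e' e (𝒢.inv k) (𝒢.translate e e' k w) = w := by
  have hr := (r_symm he hw.1).symm
  change (e (𝒢.leftMul.actT (𝒢.inv k) (e'.symm (𝒢.s (𝒢.inv k), _)))).2 = w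
  rw [𝒢.s_inv, symm_translate he he' hw, Action.inv_actT hr, e.right_inv hw.1]

theorem inv_inv_eq (k : G) : 𝒢.inv (𝒢.inv k) = k := by
  have h1 := Action.inv_actT (α := 𝒢.leftMul) (g := 𝒢.inv k) (x := k) (𝒢.s_inv k)
  rw [inv_leftMul_self, leftMul_actT ((𝒢.s_inv _).trans ((𝒢.r_inv k).trans (𝒢.r_unit _).symm))] at h1
  have h2 := 𝒢.mul_unit (𝒢.inv (𝒢.inv k))
  have h3 : 𝒢.s (𝒢.inv (𝒢.inv k)) = 𝒢.s k := (𝒢.s_inv _).trans (𝒢.r_inv k)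
  simp only [h3] at h2
  exact h2.symm.trans h1

/-- Translation by `k⁻¹` is a two-sided inverse on these domains. The exact image is what the change
of variables formula needs. -/
theorem image_translate (he : e ∈ R.atlas) (he' : e' ∈ R.atlas) (k : G) :
    𝒢.translate e e' k '' 𝒢.translateDomain e e' k = 𝒢.translateDomain e' e (𝒢.inv k) := by
  refine Subset.antisymm ?_ fun w hw => ?_
  · rintro _ ⟨w, hw, rfl⟩
    exact translate_mem he he' hw
  · have h1 := translate_mem he' he hw
    have h2 := translate_inv_translate he' he hw
    rw [inv_inv_eq] at h1 h2
    exact ⟨_, h1, h2⟩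

theorem injOn_translate (he : e ∈ R.atlas) (he' : e' ∈ R.atlas) (k : G) :
    InjOn (𝒢.translate e e' k) (𝒢.translateDomain e e' k) := fun w hw w' hw' h => by
  rw [← translate_inv_translate he he' hw, h, translate_inv_translate he he' hw']

theorem det_fderiv_translate_ne_zero (hR : 𝒢.leftMul.IsCInfZero R) (he : e ∈ R.atlas)
    (he' : e' ∈ R.atlas) {k : G} {w : V} (hw : w ∈ 𝒢.translateDomain e e' k) :
    (fderiv ℝ (𝒢.translate e e' k) w).det ≠ 0 := by
  have h1 := hasFDerivAt_translate hR he he' hw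
  have h2 := hasFDerivAt_translate hR he' he (translate_mem he he' hw)
  have h3 := h2.comp w h1
  -- Translating by `k` and back is locally the identity, so the two determinants have product one.
  have h4 : 𝒢.translate e' e (𝒢.inv k) ∘ 𝒢.translate e e' k =ᶠ[𝓝 w] id := by
    filter_upwards [(isOpen_translateDomain he k).mem_nhds hw] with v hv
    exact translate_inv_translate he he' hv
  have h5 := h3.unique ((hasFDerivAt_id w).congr_of_eventuallyEq h4)
  have h6 := congrArg ContinuousLinearMap.det h5
  intro h0
  rw [ContinuousLinearMap.det, ContinuousLinearMap.toLinearMap_comp, LinearMap.det_comp] at h6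
  rw [ContinuousLinearMap.det] at h0
  rw [h0, mul_zero] at h6
  simp [ContinuousLinearMap.det] at h6

theorem inv_mem_translateDomain (he : e ∈ R.atlas) {g : G} (hg : g ∈ e.source)
    (hg₀ : g ∈ 𝒢.sourceDomain e₀) : (e g).2 ∈ 𝒢.translateDomain e e₀ (𝒢.inv g) :=
  chart_mem_translateDomain he (𝒢.s_inv g) hg (by rw [inv_leftMul_self]; exact hg₀)

theorem jac_pos (hR : 𝒢.leftMul.IsCInfZero R) (he₀ : e₀ ∈ R.atlas) (he : e ∈ R.atlas) {g : G}
    (hg : g ∈ e.source) (hg₀ : g ∈ 𝒢.sourceDomain e₀) : 0 < 𝒢.jac e₀ e g :=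
  abs_pos.2 (det_fderiv_translate_ne_zero hR he he₀ (inv_mem_translateDomain he hg hg₀))

theorem continuousAt_jac (hR : 𝒢.leftMul.IsCInfZero R) (he₀ : e₀ ∈ R.atlas) (he : e ∈ R.atlas)
    {g : G} (hg : g ∈ e.source) (hg₀ : g ∈ 𝒢.sourceDomain e₀) :
    ContinuousAt (𝒢.jac e₀ e) g := by
  have h1 := (isCInfZeroAt_translate hR he he₀
    (inv_mem_translateDomain he hg hg₀)).continuousAt_fderiv
  have h2 : ContinuousAt (fun g => (𝒢.inv g, (e g).2)) g :=
    𝒢.continuous_inv.continuousAt.prodMk (continuousAt_snd.comp (e.continuousAt hg))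
  have h3 := ContinuousAt.comp (f := fun g => (𝒢.inv g, (e g).2)) h1 h2
  exact (ContinuousLinearMap.continuous_det.continuousAt.comp h3).abs

/-- Since `g⁻¹ = (kg)⁻¹k`, translation by `g⁻¹` factors through translation by `k`, and the chain
rule multiplies the determinants. This is the transformation law of a left invariant density; for
`k` a unit it also covers changes of chart. -/
theorem jac_eq (hR : 𝒢.leftMul.IsCInfZero R) (he₀ : e₀ ∈ R.atlas) (he : e ∈ R.atlas)
    (he' : e' ∈ R.atlas) {k g : G} (hkg : 𝒢.s k = 𝒢.r g) (hg : g ∈ e.source)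
    (hg₀ : g ∈ 𝒢.sourceDomain e₀) (hg' : 𝒢.leftMul.actT k g ∈ e'.source) :
    𝒢.jac e₀ e g = |(fderiv ℝ (𝒢.translate e e' k) (e g).2).det| *
      𝒢.jac e₀ e' (𝒢.leftMul.actT k g) := by
  have hd := chart_mem_translateDomain he hkg hg hg'
  -- Left multiplication does not change the source, so the normalizing chart remains usable at
  -- `kg`.
  have hs : 𝒢.leftMul.actT k g ∈ 𝒢.sourceDomain e₀ := by
    rw [sourceDomain, mem_ofPred_eq, s_leftMul hkg]; exact hg₀
  have hval : 𝒢.translate e e' k (e g).2 = (e' (𝒢.leftMul.actT k g)).2 := by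
    change (e' (𝒢.leftMul.actT k (e.symm (𝒢.s k, (e g).2)))).2 = _
    rw [hkg, R.symm_chart he hg]
  have h1 := hasFDerivAt_translate hR he he' hd
  have h2 := hasFDerivAt_translate hR he' he₀ (inv_mem_translateDomain he' hg' hs)
  rw [← hval] at h2
  have h3 := h2.comp _ h1
  have h4 : 𝒢.translate e e₀ (𝒢.inv g) =ᶠ[𝓝 (e g).2]
      𝒢.translate e' e₀ (𝒢.inv (𝒢.leftMul.actT k g)) ∘ 𝒢.translate e e' k := by
    filter_upwards [(isOpen_translateDomain he k).mem_nhds hd] with v hv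
    have hr : 𝒢.r g = 𝒢.r (e.symm (𝒢.s k, v)) := hkg.symm.trans (r_symm he hv.1).symm
    change _ = (e₀ (𝒢.leftMul.actT (𝒢.inv (𝒢.leftMul.actT k g))
      (e'.symm (𝒢.s (𝒢.inv (𝒢.leftMul.actT k g)), 𝒢.translate e e' k v)))).2
    rw [𝒢.s_inv, Action.p_actT hkg, symm_translate he he' hv]
    simp only [leftMul_actT hkg]
    rw [Action.inv_mul_actT hkg hr, translate, 𝒢.s_inv, ← hkg]
  have h5 := (h3.congr_of_eventuallyEq h4).fderiv
  rw [jac, h5, hval, jac, ContinuousLinearMap.det, ContinuousLinearMap.toLinearMap_comp,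
    LinearMap.det_comp, abs_mul, mul_comm]

end Translate

/-! ### Left invariant integration along the fibres of `r` -/

section Haar

variable {G G₀ V : Type*} [TopologicalSpace G] [TopologicalSpace G₀] {𝒢 : TopGroupoid G G₀}
  [NormedAddCommGroup V] [NormedSpace ℝ V] [FiniteDimensional ℝ V] {R : ContinuousFamily V 𝒢.r}

/-- The choices needed to write down a left invariant system of measures on the fibres of `r`: a
chart in which the measures are normalized at the units, and a partition of unity. -/
structure HaarData (R : ContinuousFamily V 𝒢.r) where
  e₀ : OpenPartialHomeomorph G (G₀ × V)
  mem : e₀ ∈ R.atlas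
  θ : PartitionOfUnity R.atlas G univ
  sub : θ.IsSubordinate fun e => e.1.source

/-- `ψ` is, on the fibre of `r` over `u`, a continuous function supported in the compact set `K` of
arrows with source in the domain of the normalizing chart. -/
structure IsTest (H : HaarData R) {E : Type*} [Zero E] [TopologicalSpace E] (u : G₀) (K : Set G)
    (ψ : G → E) : Prop where
  isCompact : IsCompact K
  subset : K ⊆ 𝒢.sourceDomain H.e₀
  continuousOn : ContinuousOn ψ {g | 𝒢.r g = u}
  eq_zero : ∀ g, 𝒢.r g = u → g ∉ K → ψ g = 0

variable (H : HaarData R) {E E' : Type*} [NormedAddCommGroup E] [NormedSpace ℝ E]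
  [NormedAddCommGroup E'] [NormedSpace ℝ E']

/-- The density, in the chart `e`, of the part of the left invariant measure that belongs to the
chart `e`. -/
noncomputable def weight (e : R.atlas) (g : G) : ℝ := H.θ e g * 𝒢.jac H.e₀ e.1 g

open Classical in
/-- The integrand for the part of the left invariant integral over `r⁻¹ u` that belongs to the
chart `e`. -/
noncomputable def integrand (e : R.atlas) (u : G₀) (ψ : G → E) (y : V) : E :=
  if (u, y) ∈ e.1.target then weight H e (e.1.symm (u, y)) • ψ (e.1.symm (u, y)) else 0

/-- The compact set outside which `integrand` vanishes for functions supported in `K`. -/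
def chartSupport (e : R.atlas) (K : Set G) : Set (G₀ × V) := e.1 '' (K ∩ tsupport (H.θ e))

variable [MeasurableSpace V] [BorelSpace V] (μ : Measure V) [μ.IsAddHaarMeasure]

/-- The part of the left invariant integral over `r⁻¹ u` that belongs to the chart `e`. -/
noncomputable def chartInt (e : R.atlas) (u : G₀) (ψ : G → E) : E := ∫ y, integrand H e u ψ y ∂μ

/-- The left invariant integral of `ψ` over `r⁻¹ u`. -/
noncomputable def haar (u : G₀) (ψ : G → E) : E := ∑ᶠ e : R.atlas, chartInt H μ e u ψ

variable {H μ}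

theorem isCompact_chartSupport (e : R.atlas) {K : Set G} (hK : IsCompact K) :
    IsCompact (chartSupport H e K) :=
  (hK.inter_right (isClosed_tsupport _)).image_of_continuousOn
    (e.1.continuousOn.mono fun _ hg => H.sub e hg.2)

theorem symm_mem_of_mem_chartSupport {e : R.atlas} {K : Set G} {z : G₀ × V}
    (hz : z ∈ chartSupport H e K) : z ∈ e.1.target ∧ e.1.symm z ∈ K := by
  obtain ⟨g, hg, rfl⟩ := hz
  have hs := H.sub e hg.2
  exact ⟨e.1.map_source hs, by rw [e.1.left_inv hs]; exact hg.1⟩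

theorem integrand_eq_zero {e : R.atlas} {u : G₀} {K : Set G} {ψ : G → E} {y : V}
    (hψ : ∀ g, 𝒢.r g = u → g ∉ K → ψ g = 0) (hy : (u, y) ∉ chartSupport H e K) :
    integrand H e u ψ y = 0 := by
  rw [integrand]
  split_ifs with h
  · by_cases hK : e.1.symm (u, y) ∈ K
    · have : e.1.symm (u, y) ∉ tsupport (H.θ e) := fun h' =>
        hy ⟨_, ⟨hK, h'⟩, e.1.right_inv h⟩
      rw [weight, image_eq_zero_of_notMem_tsupport this, zero_mul, zero_smul]
    · rw [hψ _ (r_symm e.2 h) hK, smul_zero]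
  · rfl

theorem continuousAt_weight (hR : 𝒢.leftMul.IsCInfZero R) {e : R.atlas} {g : G}
    (hg : g ∈ e.1.source) (hg₀ : g ∈ 𝒢.sourceDomain H.e₀) : ContinuousAt (weight H e) g :=
  (H.θ e).continuous.continuousAt.mul (continuousAt_jac hR H.mem e.2 hg hg₀)

theorem weight_nonneg (e : R.atlas) (g : G) : 0 ≤ weight H e g :=
  mul_nonneg (H.θ.nonneg e g) (abs_nonneg _)

variable [T2Space G] [T2Space G₀]

theorem hasCompactSupport_integrand {e : R.atlas} {u : G₀} {K : Set G} {ψ : G → E}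
    (hψ : IsTest H u K ψ) : HasCompactSupport (integrand H e u ψ) := by
  refine HasCompactSupport.intro ((isCompact_chartSupport e hψ.isCompact).image continuous_snd)
    fun y hy => integrand_eq_zero hψ.eq_zero fun h => hy ⟨_, h, rfl⟩

theorem continuous_integrand (hR : 𝒢.leftMul.IsCInfZero R) {e : R.atlas} {u : G₀} {K : Set G}
    {ψ : G → E} (hψ : IsTest H u K ψ) : Continuous (integrand H e u ψ) := by
  have hQ := isCompact_chartSupport (H := H) e hψ.isCompact
  rw [continuous_iff_continuousAt]
  intro y
  -- On the compact set `chartSupport` the defining formula is continuous. Its complement is open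
  -- and the integrand vanishes there, which deals with the boundary of the chart.
  by_cases hy : (u, y) ∈ chartSupport H e K
  · obtain ⟨ht, hK⟩ := symm_mem_of_mem_chartSupport hy
    have hopen : IsOpen {y | (u, y) ∈ e.1.target} :=
      e.1.open_target.preimage (Continuous.prodMk_right u)
    have hs : ContinuousAt (fun y => e.1.symm (u, y)) y :=
      (e.1.continuousAt_symm ht).comp (f := fun y => (u, y)) (by fun_prop)
    have h1 : ContinuousAt (fun y => ψ (e.1.symm (u, y))) y := by
      refine ContinuousOn.continuousAt (hψ.continuousOn.comp (t := {g | 𝒢.r g = u})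
        (s := {y | (u, y) ∈ e.1.target}) (e.1.continuousOn_symm.comp (by fun_prop) fun _ h => h)
        fun y' hy' => ?_) (hopen.mem_nhds ht)
      exact r_symm e.2 hy'
    have h2 : ContinuousAt (fun y => weight H e (e.1.symm (u, y))) y :=
      ContinuousAt.comp (f := fun y => e.1.symm (u, y)) (x := y)
        (continuousAt_weight hR (e.1.map_target ht) (hψ.subset hK)) hs
    refine (h2.smul h1).congr ?_
    filter_upwards [hopen.mem_nhds ht] with y' hy'
    exact (if_pos hy').symm
  · have hopen : IsOpen {y | (u, y) ∉ chartSupport H e K} :=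
      hQ.isClosed.isOpen_compl.preimage (Continuous.prodMk_right u)
    refine (continuousAt_const (y := (0 : E))).congr ?_
    filter_upwards [hopen.mem_nhds hy] with y' hy'
    exact (integrand_eq_zero hψ.eq_zero hy').symm

theorem integrable_integrand (hR : 𝒢.leftMul.IsCInfZero R) {e : R.atlas} {u : G₀} {K : Set G}
    {ψ : G → E} (hψ : IsTest H u K ψ) : Integrable (integrand H e u ψ) μ :=
  (continuous_integrand hR hψ).integrable_of_hasCompactSupport (hasCompactSupport_integrand hψ)

theorem chartInt_sum (hR : 𝒢.leftMul.IsCInfZero R) {ι : Type*} (s : Finset ι) (e : R.atlas)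
    {u : G₀} {K : Set G} {ψ : ι → G → E} (hψ : ∀ i ∈ s, IsTest H u K (ψ i)) :
    chartInt H μ e u (fun g => ∑ i ∈ s, ψ i g) = ∑ i ∈ s, chartInt H μ e u (ψ i) := by
  simp only [chartInt]
  rw [← integral_finsetSum _ fun i hi => integrable_integrand hR (hψ i hi)]
  congr 1
  ext y
  simp only [integrand]
  split_ifs
  · exact Finset.smul_sum
  · simp

theorem chartInt_congr (e : R.atlas) {u : G₀} {ψ ψ' : G → E}
    (h : ∀ g ∈ e.1.source, 𝒢.r g = u → H.θ e g ≠ 0 → ψ g = ψ' g) :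
    chartInt H μ e u ψ = chartInt H μ e u ψ' := by
  simp only [chartInt]
  congr 1
  ext y
  simp only [integrand]
  split_ifs with hy
  · by_cases h0 : H.θ e (e.1.symm (u, y)) = 0
    · simp [weight, h0]
    · rw [h _ (e.1.map_target hy) (r_symm e.2 hy) h0]
  · rfl

theorem haar_congr {u : G₀} {ψ ψ' : G → E} (h : ∀ g, 𝒢.r g = u → ψ g = ψ' g) :
    haar H μ u ψ = haar H μ u ψ' :=
  finsum_congr fun e => chartInt_congr e fun g _ hr _ => h g hr

variable (H) in
-- By local finiteness only finitely many partition functions are nonzero somewhere on `K`. Allowing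
-- any larger `t` lets integrals of functions with different values in `E` and `E'` be compared over
-- one index set.
theorem exists_finset_haar {K : Set G} (hK : IsCompact K) : ∃ s : Finset R.atlas,
    (∀ g ∈ K, ∑ e ∈ s, H.θ e g = 1) ∧ ∀ (t : Finset R.atlas), s ⊆ t → ∀ (u : G₀) (ψ : G → E),
      (∀ g, 𝒢.r g = u → g ∉ K → ψ g = 0) → haar H μ u ψ = ∑ e ∈ t, chartInt H μ e u ψ := by
  have hfin := H.θ.locallyFinite.finite_nonempty_inter_compact hK
  refine ⟨hfin.toFinset, fun g hg => ?_, fun t ht u ψ hψ => ?_⟩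
  · rw [← H.θ.sum_eq_one (mem_univ g)]
    refine (finsum_eq_sum_of_support_subset _ fun e he => ?_).symm
    simp only [Finite.coe_toFinset]
    exact ⟨g, he, hg⟩
  · refine finsum_eq_sum_of_support_subset _ fun e he => ht ?_
    simp only [Finite.mem_toFinset]
    by_contra hne
    refine he ((chartInt_congr e (ψ' := fun _ => 0) fun g _ hr h0 => ?_).trans ?_)
    · exact hψ g hr fun hK => hne ⟨g, h0, hK⟩
    · simp [chartInt, integrand]

theorem haar_clm (hR : 𝒢.leftMul.IsCInfZero R) [CompleteSpace E] [CompleteSpace E']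
    (L : E →L[ℝ] E') {u : G₀} {K : Set G} {ψ : G → E} (hψ : IsTest H u K ψ) :
    haar H μ u (fun g => L (ψ g)) = L (haar H μ u ψ) := by
  obtain ⟨s, -, hs⟩ := exists_finset_haar (E := E) (μ := μ) H hψ.isCompact
  obtain ⟨s', -, hs'⟩ := exists_finset_haar (E := E') (μ := μ) H hψ.isCompact
  classical
  rw [hs (s ∪ s') Finset.subset_union_left u ψ hψ.eq_zero,
    hs' (s ∪ s') Finset.subset_union_right u _ (fun g hr hK => by
      rw [hψ.eq_zero g hr hK, map_zero]), map_sum]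
  refine Finset.sum_congr rfl fun e _ => ?_
  rw [chartInt, chartInt, ← L.integral_comp_comm (integrable_integrand hR hψ)]
  congr 1
  ext y
  simp only [integrand]
  split_ifs
  · rw [map_smul]
  · rw [map_zero]

theorem haar_add (hR : 𝒢.leftMul.IsCInfZero R) {u : G₀} {K : Set G} {ψ ψ' : G → E}
    (hψ : IsTest H u K ψ) (hψ' : IsTest H u K ψ') :
    haar H μ u (fun g => ψ g + ψ' g) = haar H μ u ψ + haar H μ u ψ' := by
  obtain ⟨s, -, hs⟩ := exists_finset_haar (E := E) (μ := μ) H hψ.isCompact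
  rw [hs s subset_rfl u ψ hψ.eq_zero, hs s subset_rfl u ψ' hψ'.eq_zero,
    hs s subset_rfl u _ fun g hr hK => by rw [hψ.eq_zero g hr hK, hψ'.eq_zero g hr hK, add_zero],
    ← Finset.sum_add_distrib]
  refine Finset.sum_congr rfl fun e _ => ?_
  rw [chartInt, chartInt, chartInt,
    ← integral_add (integrable_integrand hR hψ) (integrable_integrand hR hψ')]
  congr 1
  ext y
  simp only [integrand]
  split_ifs
  · rw [smul_add]
  · rw [add_zero]

theorem integrand_nonneg {e : R.atlas} {u : G₀} {ψ : G → ℝ} (h0 : ∀ g, 𝒢.r g = u → 0 ≤ ψ g)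
    (y : V) : 0 ≤ integrand H e u ψ y := by
  rw [integrand]
  split_ifs with hy
  · exact smul_nonneg (weight_nonneg e _) (h0 _ (r_symm e.2 hy))
  · exact le_rfl

theorem haar_nonneg {u : G₀} {ψ : G → ℝ} (h0 : ∀ g, 𝒢.r g = u → 0 ≤ ψ g) :
    0 ≤ haar H μ u ψ :=
  finsum_nonneg fun _ => integral_nonneg (integrand_nonneg h0)

/-- All chart contributions are non-negative. Some partition function is nonzero at `g`, and in its
chart a continuous non-negative integrand that is nonzero at the image of `g` has positive integral.
-/
theorem haar_pos (hR : 𝒢.leftMul.IsCInfZero R) {u : G₀} {K : Set G} {ψ : G → ℝ}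
    (hψ : IsTest H u K ψ) (h0 : ∀ g, 𝒢.r g = u → 0 ≤ ψ g) {g : G} (hg : 𝒢.r g = u)
    (hne : ψ g ≠ 0) : 0 < haar H μ u ψ := by
  obtain ⟨s, hs1, hs⟩ := exists_finset_haar (E := ℝ) (μ := μ) H hψ.isCompact
  have hK : g ∈ K := by
    by_contra hK
    exact hne (hψ.eq_zero g hg hK)
  rw [hs s subset_rfl u ψ hψ.eq_zero]
  obtain ⟨e, he, hθ⟩ : ∃ e ∈ s, H.θ e g ≠ 0 := by
    by_contra! hcon
    have := hs1 g hK
    rw [Finset.sum_eq_zero hcon] at this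
    exact zero_ne_one this
  refine Finset.sum_pos' (fun e _ => integral_nonneg (integrand_nonneg h0)) ⟨e, he, ?_⟩
  have hgs : g ∈ e.1.source := H.sub e (subset_tsupport _ hθ)
  refine (continuous_integrand hR hψ).integral_pos_of_hasCompactSupport_nonneg_nonzero
    (hasCompactSupport_integrand hψ) (integrand_nonneg h0) (x := (e.1 g).2) ?_
  have h1 : (u, (e.1 g).2) = e.1 g := by rw [← hg]; exact R.chart_eq e.2 hgs
  rw [integrand, if_pos (by rw [h1]; exact e.1.map_source hgs), h1, e.1.left_inv hgs, weight]
  exact smul_ne_zero (mul_ne_zero hθ (jac_pos hR H.mem e.2 hgs (hψ.subset hK)).ne') hne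

/-- Change of variables under a left translation, in charts. -/
theorem chartInt_translate (hR : 𝒢.leftMul.IsCInfZero R) (e e' : R.atlas) {k : G} {ψ : G → E}
    (hψ : ∀ g, 𝒢.r g = 𝒢.r k → g ∉ 𝒢.sourceDomain H.e₀ → ψ g = 0) :
    chartInt H μ e (𝒢.s k)
        (fun g => H.θ e' (𝒢.leftMul.actT k g) • ψ (𝒢.leftMul.actT k g)) =
      chartInt H μ e' (𝒢.r k) (fun g => H.θ e (𝒢.leftMul.actT (𝒢.inv k) g) • ψ g) := by
  have hθ0 : ∀ (e : R.atlas) g, g ∉ e.1.source → H.θ e g = 0 := fun e g hg =>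
    image_eq_zero_of_notMem_tsupport fun h => hg (H.sub e h)
  have hS := (isOpen_translateDomain (e' := e'.1) e.2 k).measurableSet
  have key := integral_image_eq_integral_abs_det_fderiv_smul μ hS
    (fun w hw => (hasFDerivAt_translate hR e.2 e'.2 hw).hasFDerivWithinAt)
    (injOn_translate e.2 e'.2 k)
    (integrand H e' (𝒢.r k) fun g => H.θ e (𝒢.leftMul.actT (𝒢.inv k) g) • ψ g)
  -- The cutoffs `θ_{e'}(kg)` and `θ_e(k⁻¹g)` vanish off the respective charts, so each full
  -- integral equals the integral over the matching translation domain.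
  rw [image_translate e.2 e'.2, setIntegral_eq_integral_of_forall_compl_eq_zero] at key
  · rw [chartInt, chartInt, key, ← setIntegral_eq_integral_of_forall_compl_eq_zero
      (s := 𝒢.translateDomain e.1 e'.1 k)]
    · refine setIntegral_congr_fun hS fun w hw => ?_
      have hr : 𝒢.s k = 𝒢.r (e.1.symm (𝒢.s k, w)) := (r_symm e.2 hw.1).symm
      have ht : (𝒢.r k, 𝒢.translate e.1 e'.1 k w) ∈ e'.1.target := by
        have := (translate_mem e.2 e'.2 hw).1
        rwa [𝒢.s_inv] at this
      simp only [integrand]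
      rw [if_pos hw.1, if_pos ht, symm_translate e.2 e'.2 hw, Action.inv_actT hr]
      -- `jac_eq` applies only to arrows in the source domain; for the others `ψ` vanishes and both
      -- sides are zero.
      by_cases hO : e.1.symm (𝒢.s k, w) ∈ 𝒢.sourceDomain H.e₀
      · rw [weight, weight, jac_eq hR H.mem e.2 e'.2 hr (e.1.map_target hw.1) hO hw.2,
          e.1.right_inv hw.1]
        simp only [smul_smul]
        congr 1
        ring
      · rw [hψ (𝒢.leftMul.actT k (e.1.symm (𝒢.s k, w))) (Action.p_actT hr)]
        · simp
        · rwa [sourceDomain, mem_ofPred_eq, s_leftMul hr]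
    · intro w hw
      rw [integrand]
      split_ifs with ht
      · rw [hθ0 e' _ fun h => hw ⟨ht, h⟩, zero_smul, smul_zero]
      · rfl
  · intro w hw
    rw [integrand]
    split_ifs with ht
    · rw [hθ0 e _ fun h => hw ⟨by rwa [𝒢.s_inv], by rwa [𝒢.s_inv]⟩, zero_smul, smul_zero]
    · rfl

theorem continuousOn_leftMul (k : G) :
    ContinuousOn (𝒢.leftMul.actT k) {g | 𝒢.r g = 𝒢.s k} :=
  𝒢.leftMul.continuousOn_actT.comp (f := fun g => (k, g)) (by fun_prop) fun _ hg => hg.symm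

/-- The support moves by `k⁻¹` and stays in the source domain because sources are preserved. It is
cut down to the fibre over `r k`, where this translation is defined. -/
theorem IsTest.translate {k : G} {K : Set G} {ψ : G → E} (hψ : IsTest H (𝒢.r k) K ψ) :
    IsTest H (𝒢.s k) (𝒢.leftMul.actT (𝒢.inv k) '' (K ∩ {g | 𝒢.r g = 𝒢.r k}))
      (fun g => ψ (𝒢.leftMul.actT k g)) where
  isCompact := by
    refine IsCompact.image_of_continuousOn (hψ.isCompact.inter_right
      (isClosed_singleton.preimage 𝒢.continuous_r)) ?_
    have := continuousOn_leftMul (𝒢 := 𝒢) (𝒢.inv k)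
    rw [𝒢.s_inv] at this
    exact this.mono inter_subset_right
  subset := by
    rintro _ ⟨g, ⟨hg, hr⟩, rfl⟩
    rw [sourceDomain, mem_ofPred_eq, s_leftMul ((𝒢.s_inv k).trans (Eq.symm hr))]
    exact hψ.subset hg
  continuousOn := hψ.continuousOn.comp (continuousOn_leftMul k) fun g hg =>
    Action.p_actT (Eq.symm hg)
  eq_zero g hg hK := by
    refine hψ.eq_zero _ (Action.p_actT hg.symm) fun h => hK ?_
    exact ⟨_, ⟨h, Action.p_actT hg.symm⟩, Action.inv_actT hg.symm⟩

theorem IsTest.smul {u : G₀} {K : Set G} {ψ : G → E} (hψ : IsTest H u K ψ) {φ : G → ℝ}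
    (hφ : ContinuousOn φ {g | 𝒢.r g = u}) : IsTest H u K (fun g => φ g • ψ g) where
  isCompact := hψ.isCompact
  subset := hψ.subset
  continuousOn := hφ.smul hψ.continuousOn
  eq_zero g hg hK := by rw [hψ.eq_zero g hg hK, smul_zero]

/-- Left invariance. -/
theorem haar_translate (hR : 𝒢.leftMul.IsCInfZero R) {k : G} {K : Set G} {ψ : G → E}
    (hψ : IsTest H (𝒢.r k) K ψ) :
    haar H μ (𝒢.s k) (fun g => ψ (𝒢.leftMul.actT k g)) = haar H μ (𝒢.r k) ψ := by
  have hψ' := hψ.translate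
  obtain ⟨s, hs1, hs⟩ := exists_finset_haar (E := E) (μ := μ) H hψ.isCompact
  obtain ⟨s', hs1', hs'⟩ := exists_finset_haar (E := E) (μ := μ) H hψ'.isCompact
  rw [hs s subset_rfl _ _ hψ.eq_zero, hs' s' subset_rfl _ _ hψ'.eq_zero]
  have hc : ∀ e' : R.atlas, ContinuousOn (fun g => H.θ e' (𝒢.leftMul.actT k g))
      {g | 𝒢.r g = 𝒢.s k} := fun e' =>
    (H.θ e').continuous.comp_continuousOn (continuousOn_leftMul k)
  have hc' : ∀ e : R.atlas, ContinuousOn (fun g => H.θ e (𝒢.leftMul.actT (𝒢.inv k) g))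
      {g | 𝒢.r g = 𝒢.r k} := fun e => by
    have := continuousOn_leftMul (𝒢 := 𝒢) (𝒢.inv k)
    rw [𝒢.s_inv] at this
    exact (H.θ e).continuous.comp_continuousOn this
  -- The relation `∑ θ_{e'}(kg) = 1` is inserted, each double term is moved by `chartInt_translate`,
  -- and `∑ θ_e(k⁻¹g) = 1` is removed on the other side.
  calc ∑ e ∈ s', chartInt H μ e (𝒢.s k) (fun g => ψ (𝒢.leftMul.actT k g))
      = ∑ e ∈ s', ∑ e' ∈ s, chartInt H μ e (𝒢.s k)
          (fun g => H.θ e' (𝒢.leftMul.actT k g) • ψ (𝒢.leftMul.actT k g)) := by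
        refine Finset.sum_congr rfl fun e _ => ?_
        rw [← chartInt_sum hR s e fun e' _ => hψ'.smul (hc e')]
        refine chartInt_congr e fun g _ hr _ => ?_
        rw [← Finset.sum_smul]
        by_cases hK : 𝒢.leftMul.actT k g ∈ K
        · rw [hs1 _ hK, one_smul]
        · rw [hψ.eq_zero _ (Action.p_actT hr.symm) hK, smul_zero]
    _ = ∑ e' ∈ s, ∑ e ∈ s', chartInt H μ e' (𝒢.r k)
          (fun g => H.θ e (𝒢.leftMul.actT (𝒢.inv k) g) • ψ g) := by
        rw [Finset.sum_comm]
        exact Finset.sum_congr rfl fun e' _ => Finset.sum_congr rfl fun e _ =>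
          chartInt_translate hR e e' fun g hr hO => hψ.eq_zero g hr fun h => hO (hψ.subset h)
    _ = ∑ e' ∈ s, chartInt H μ e' (𝒢.r k) ψ := by
        refine Finset.sum_congr rfl fun e' _ => ?_
        rw [← chartInt_sum hR s' e' fun e _ => hψ.smul (hc' e)]
        refine chartInt_congr e' fun g _ hr _ => ?_
        rw [← Finset.sum_smul]
        by_cases hK : g ∈ K
        · rw [hs1' _ ⟨g, ⟨hK, hr⟩, rfl⟩, one_smul]
        · rw [hψ.eq_zero _ hr hK, smul_zero]

/-- The left invariant integral of a family of functions of class `C^{∞,0}` is of class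
`C^{∞,0}`. -/
theorem isCInfZeroAt_haar (hR : 𝒢.leftMul.IsCInfZero R) {W : Type*} [NormedAddCommGroup W]
    [NormedSpace ℝ W] [FiniteDimensional ℝ W] {Ω : Set (G₀ × W)} (hΩ : IsOpen Ω) {K : Set G}
    (hK : IsCompact K) (hKO : K ⊆ 𝒢.sourceDomain H.e₀) {Ψ : G × W → E}
    (hΨ : ∀ g w, (𝒢.r g, w) ∈ Ω → IsCInfZeroAt Ψ (g, w))
    (hΨK : ∀ g w, (𝒢.r g, w) ∈ Ω → g ∉ K → Ψ (g, w) = 0) {z : G₀ × W} (hz : z ∈ Ω) :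
    IsCInfZeroAt (fun z : G₀ × W => haar H μ z.1 fun g => Ψ (g, z.2)) z := by
  obtain ⟨s, -, hs⟩ := exists_finset_haar (E := E) (μ := μ) H hK
  have h1 : IsCInfZeroAt (fun z : G₀ × W => ∑ e ∈ s, chartInt H μ e z.1 fun g => Ψ (g, z.2)) z := by
    refine isCInfZeroAt_sum s fun e _ => ?_
    have hQ := isCompact_chartSupport (H := H) e hK
    refine isCInfZeroAt_integral (μ := μ)
      (b := fun x : (G₀ × V) × W => integrand H e x.1.1 (fun g => Ψ (g, x.2)) x.1.2)
      hΩ (hQ.image continuous_snd) (fun t w hw y => ?_) (fun t w hw y hy => ?_) hz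
    -- Here `(t, y)`, hence the arrow, is the parameter: the weight need only be continuous, and
    -- only `Ψ` is differentiated, in `w`.
    · by_cases hy : (t, y) ∈ chartSupport H e K
      · obtain ⟨ht, hgK⟩ := symm_mem_of_mem_chartSupport hy
        have hs := e.1.continuousAt_symm ht
        have hr : 𝒢.r (e.1.symm (t, y)) = t := r_symm e.2 ht
        have h2 : IsCInfZeroAt (fun x : (G₀ × V) × W => weight H e (e.1.symm x.1)) ((t, y), w) :=
          isCInfZeroAt_of_continuousAt (a := fun v : G₀ × V => weight H e (e.1.symm v))
            (ContinuousAt.comp (continuousAt_weight hR (e.1.map_target ht) (hKO hgK)) hs)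
        have h3 : IsCInfZeroAt (fun x : (G₀ × V) × W => Ψ (e.1.symm x.1, x.2)) ((t, y), w) :=
          (hΨ (e.1.symm (t, y)) w (by rwa [hr])).comp_base (z := ((t, y), w)) hs
        refine (h2.smul h3).congr ?_
        filter_upwards [(e.1.open_target.preimage continuous_fst).mem_nhds
          (show ((t, y), w).1 ∈ e.1.target from ht)] with x hx
        exact (if_pos hx).symm
      · have hopen : IsOpen {x : (G₀ × V) × W | x.1 ∉ chartSupport H e K ∧ (x.1.1, x.2) ∈ Ω} :=
          (hQ.isClosed.isOpen_compl.preimage continuous_fst).inter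
            (hΩ.preimage (by fun_prop : Continuous fun x : (G₀ × V) × W => (x.1.1, x.2)))
        refine (isCInfZeroAt_of_continuousAt (a := fun _ : G₀ × V => (0 : E))
          continuousAt_const).congr ?_
        filter_upwards [hopen.mem_nhds (show _ ∧ _ from ⟨hy, hw⟩)] with x hx
        exact (integrand_eq_zero (fun g hr hg => hΨK g x.2 (by rw [hr]; exact hx.2) hg) hx.1).symm
    · exact integrand_eq_zero (fun g hr hg => hΨK g w (by rwa [hr]) hg) fun h => hy ⟨_, h, rfl⟩
  refine h1.congr ?_
  filter_upwards [hΩ.mem_nhds hz] with x hx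
  exact (hs s subset_rfl x.1 _ fun g hr hg => hΨK g x.2 (by rw [hr]; exact hx) hg).symm

end Haar

end TopGroupoid

/-! ### Functions and bump functions of class `C^{∞,0}` on a continuous family -/

section Bumps

variable {T X V E' : Type*} [TopologicalSpace T] [TopologicalSpace X]
  [NormedAddCommGroup V] [NormedSpace ℝ V] [FiniteDimensional ℝ V] {p : X → T}
  [NormedAddCommGroup E'] [NormedSpace ℝ E'] {A : ContinuousFamily V p}

variable (A) in
/-- `f` is a function of class `C^{∞,0}` near `x`, that is, it is so in all charts. -/
def IsSmoothAt (f : X → E') (x : X) : Prop :=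
  ∀ c ∈ A.atlas, x ∈ c.source → IsCInfZeroAt (fun z => f (c.symm z)) (c x)

theorem IsSmoothAt.continuousAt {f : X → E'} {x : X} (hf : IsSmoothAt A f x) :
    ContinuousAt f x := by
  obtain ⟨c, hc, hx⟩ := A.cover x
  refine (ContinuousAt.comp (hf c hc hx).continuousAt (c.continuousAt hx)).congr ?_
  filter_upwards [c.open_source.mem_nhds hx] with x' hx'
  simp [c.left_inv hx']

theorem isMorphism_point {f : X → E'} (hf : ∀ x, IsSmoothAt A f x) :
    IsMorphism A (ContinuousFamily.point E') (fun _ => ()) f where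
  continuous_base := continuous_const
  continuousOn := (continuous_iff_continuousAt.2 fun x => (hf x).continuousAt).continuousOn
  fiber := fun _ _ => rfl
  local_form := by
    rintro c hc _ rfl
    have hU : c.target ∩ c.symm ⁻¹' (univ ∩ f ⁻¹'
        ((Homeomorph.punitProd E').symm.toOpenPartialHomeomorph).source) = c.target := by
      ext z; simp
    rw [hU, isCInfZeroOn_iff c.open_target]
    intro z hz
    have := hf (c.symm z) c hc (c.map_target hz)
    rw [c.right_inv hz] at this
    exact this

theorem isCInfZeroAt_transition {c c' : OpenPartialHomeomorph X (T × V)} (hc : c ∈ A.atlas)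
    (hc' : c' ∈ A.atlas) {x : X} (hx : x ∈ c.source) (hx' : x ∈ c'.source) :
    IsCInfZeroAt (fun z => (c' (c.symm z)).2) (c x) :=
  (isCInfZeroOn_iff (c.isOpen_inter_preimage_symm c'.open_source)).1 (A.compat c hc c' hc') _
    ⟨c.map_source hx, by rw [mem_preimage, c.left_inv hx]; exact hx'⟩

/-- One chart suffices, because transition maps are `C^{∞,0}` and fix the parameter. -/
theorem IsSmoothAt.of_chart {f : X → E'} {x : X} {c : OpenPartialHomeomorph X (T × V)}
    (hc : c ∈ A.atlas) (hx : x ∈ c.source) (hf : IsCInfZeroAt (fun z => f (c.symm z)) (c x)) :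
    IsSmoothAt A f x := by
  intro c' hc' hx'
  have h1 := isCInfZeroAt_transition hc' hc hx' hx
  have hp : ∀ y ∈ c.source, (p y, (c y).2) = c y := fun y hy => A.chart_eq hc hy
  have h2 : IsCInfZeroAt (fun z : T × V => f (c.symm (z.1, (c (c'.symm z)).2))) (c' x) := by
    refine IsCInfZeroAt.comp (f₂ := fun z : T × V => f (c.symm z)) (q := id) ?_ continuousAt_id h1
    change IsCInfZeroAt (fun z => f (c.symm z)) ((c' x).1, (c (c'.symm (c' x))).2)
    rwa [c'.left_inv hx', A.chart_fst c' hc' x hx', hp x hx]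
  refine h2.congr ?_
  have hev : ∀ᶠ z in 𝓝 (c' x), z ∈ c'.target ∩ c'.symm ⁻¹' c.source :=
    (c'.isOpen_inter_preimage_symm c.open_source).mem_nhds
      ⟨c'.map_source hx', by rw [mem_preimage, c'.left_inv hx']; exact hx⟩
  filter_upwards [hev] with z hz
  rw [← A.p_symm hc' hz.1, A.symm_chart hc hz.2]

theorem IsSmoothAt.congr {f g : X → E'} {x : X} (hf : IsSmoothAt A f x) (h : f =ᶠ[𝓝 x] g) :
    IsSmoothAt A g x := fun c hc hx => (hf c hc hx).congr <| by
  have h1 : Tendsto c.symm (𝓝 (c x)) (𝓝 x) := by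
    have := c.continuousAt_symm (c.map_source hx)
    rwa [ContinuousAt, c.left_inv hx] at this
  exact h1.eventually h

theorem isSmoothAt_zero (x : X) : IsSmoothAt A (fun _ => (0 : E')) x := fun _ _ _ =>
  isCInfZeroAt_of_continuousAt (a := fun _ : T => (0 : E')) continuousAt_const

theorem isSmoothAt_sum {ι : Type*} (s : Finset ι) {f : ι → X → E'} {x : X}
    (hf : ∀ i ∈ s, IsSmoothAt A (f i) x) : IsSmoothAt A (fun x => ∑ i ∈ s, f i x) x :=
  fun c hc hx => isCInfZeroAt_sum s fun i hi => hf i hi c hc hx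

variable (A) in
/-- `χ` is a non-negative function of class `C^{∞,0}` which vanishes outside the compact set
`C`. -/
structure IsBump (C : Set X) (χ : X → ℝ) : Prop where
  isCompact : IsCompact C
  nonneg : ∀ x, 0 ≤ χ x
  eq_zero : ∀ x ∉ C, χ x = 0
  smooth : ∀ x, IsSmoothAt A χ x

variable (A) in
-- In a chart, take the product of a Urysohn function of the parameter with a smooth bump function
-- of the fibre coordinate. It extends by zero since its support lies in a compact, hence closed,
-- subset of the chart.
theorem exists_isBump [T2Space X] [T2Space T] [LocallyCompactSpace T] {x₀ : X} {N : Set X}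
    (hN : N ∈ 𝓝 x₀) : ∃ C χ, IsBump A C χ ∧ C ⊆ N ∧ χ x₀ ≠ 0 := by
  classical
  have : ProperSpace V := FiniteDimensional.proper_real V
  obtain ⟨c, hc, hx₀⟩ := A.cover x₀
  have hU : c.target ∩ c.symm ⁻¹' N ∈ 𝓝 (c x₀) := by
    refine inter_mem (c.open_target.mem_nhds (c.map_source hx₀)) ?_
    refine (c.continuousAt_symm (c.map_source hx₀)).preimage_mem_nhds ?_
    rwa [c.left_inv hx₀]
  obtain ⟨a, ha, b, hb, hab⟩ := mem_nhds_prod_iff.1 hU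
  obtain ⟨k, hk, hka, hkc⟩ := local_compact_nhds ha
  obtain ⟨r, hr, hrb⟩ := Metric.nhds_basis_closedBall.mem_iff.1 hb
  obtain ⟨φ, hφ1, hφ0, -, hφ⟩ := exists_continuous_one_zero_of_isCompact
    (isCompact_singleton (x := (c x₀).1)) (isOpen_interior (s := k)).isClosed_compl
    (by rw [disjoint_compl_right_iff_subset, singleton_subset_iff]
        exact mem_interior_iff_mem_nhds.2 hk)
  let ψ : ContDiffBump (c x₀).2 := ⟨r / 2, r, half_pos hr, half_lt_self hr⟩
  have hψ0 : ∀ w ∉ Metric.closedBall (c x₀).2 r, ψ w = 0 := fun w hw =>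
    ψ.zero_of_le_dist (le_of_lt (not_le.1 hw))
  have hsub : k ×ˢ Metric.closedBall (c x₀).2 r ⊆ c.target ∩ c.symm ⁻¹' N :=
    (prod_mono hka hrb).trans hab
  set C := c.symm '' (k ×ˢ Metric.closedBall (c x₀).2 r) with hC
  have hCc : IsCompact C := (hkc.prod (isCompact_closedBall _ _)).image_of_continuousOn
    (c.continuousOn_symm.mono fun z hz => (hsub hz).1)
  let χ : X → ℝ := fun x => if x ∈ c.source then φ (p x) * ψ (c x).2 else 0
  have hχ0 : ∀ x ∉ C, χ x = 0 := by
    intro x hx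
    change ite _ _ _ = _
    split_ifs with hxs
    · by_cases h1 : (c x).1 ∈ k
      · have h2 : (c x).2 ∉ Metric.closedBall (c x₀).2 r := fun h2 =>
          hx ⟨c x, ⟨h1, h2⟩, c.left_inv hxs⟩
        rw [hψ0 _ h2, mul_zero]
      · rw [← A.chart_fst c hc x hxs, hφ0 fun h => h1 (interior_subset h)]
        simp
    · rfl
  refine ⟨C, χ, ⟨hCc, fun x => ?_, hχ0, fun x => ?_⟩, ?_, ?_⟩
  · change 0 ≤ ite _ _ _
    split_ifs
    · exact mul_nonneg (hφ _).1 ψ.nonneg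
    · exact le_rfl
  · by_cases hx : x ∈ c.source
    · refine IsSmoothAt.of_chart hc hx ?_
      have h1 : IsCInfZeroAt (fun z : T × V => φ z.1) (c x) :=
        isCInfZeroAt_of_continuousAt (a := φ) φ.continuous.continuousAt
      have h2 : IsCInfZeroAt (fun z : T × V => ψ z.2) (c x) :=
        isCInfZeroAt_of_contDiff ψ.contDiff _
      refine (h1.smul h2).congr ?_
      filter_upwards [c.open_target.mem_nhds (c.map_source hx)] with z hz
      change _ = ite _ _ _
      rw [if_pos (c.map_target hz), A.p_symm hc hz, c.right_inv hz, smul_eq_mul]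
    · have hxC : x ∉ C := by
        rintro ⟨z, hz, rfl⟩
        exact hx (c.map_target (hsub hz).1)
      refine (isSmoothAt_zero x).congr ?_
      filter_upwards [hCc.isClosed.isOpen_compl.mem_nhds hxC] with y hy using (hχ0 y hy).symm
  · rintro _ ⟨z, hz, rfl⟩
    exact (hsub hz).2
  · change ite _ _ _ ≠ _
    rw [if_pos hx₀, ← A.chart_fst c hc x₀ hx₀, hφ1 rfl,
      ψ.one_of_mem_closedBall (Metric.mem_closedBall_self ψ.rIn_pos.le)]
    simp

end Bumps

/-! ### The unit space and the choice of Haar data -/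

namespace TopGroupoid

variable {G G₀ : Type*} [TopologicalSpace G] [TopologicalSpace G₀] {𝒢 : TopGroupoid G G₀}

theorem t2Space_units [T2Space G] (𝒢 : TopGroupoid G G₀) : T2Space G₀ :=
  𝒢.isEmbedding_unit.t2Space

theorem surjective_r (𝒢 : TopGroupoid G G₀) : Function.Surjective 𝒢.r := fun u =>
  ⟨𝒢.unit u, 𝒢.r_unit u⟩

theorem locallyCompactSpace_units [LocallyCompactSpace G] (h : IsOpenMap 𝒢.r) :
    LocallyCompactSpace G₀ :=
  IsOpenQuotientMap.locallyCompactSpace (f := 𝒢.r) ⟨𝒢.surjective_r, 𝒢.continuous_r, h⟩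

theorem exists_haarData [T2Space G] [LocallyCompactSpace G] [SecondCountableTopology G]
    {V : Type*} [NormedAddCommGroup V] [NormedSpace ℝ V] (R : ContinuousFamily V 𝒢.r) (u : G₀) :
    ∃ H : HaarData R, 𝒢.unit u ∈ H.e₀.source := by
  obtain ⟨e₀, he₀, hu⟩ := R.cover (𝒢.unit u)
  obtain ⟨θ, hθ⟩ := PartitionOfUnity.exists_isSubordinate isClosed_univ
    (fun e : R.atlas => e.1.source) (fun e => e.1.open_source) fun g _ =>
      let ⟨e, he, hg⟩ := R.cover g
      mem_iUnion.2 ⟨⟨e, he⟩, hg⟩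
  exact ⟨⟨e₀, he₀, θ, hθ⟩, hu⟩

/-! ### The orbit space -/

universe u

namespace Action

variable {X : Type*} [TopologicalSpace X] {p : X → G₀} {α : 𝒢.Action p}

variable (α) in
/-- The equivalence relation whose classes are the orbits. -/
def orbitSetoid : Setoid X where
  r x y := ∃ g, 𝒢.s g = p x ∧ α.actT g x = y
  iseqv := by
    refine ⟨fun x => ⟨𝒢.unit (p x), 𝒢.s_unit _, unit_actT x⟩, ?_, ?_⟩
    · rintro x _ ⟨g, hg, rfl⟩
      exact ⟨𝒢.inv g, (𝒢.s_inv g).trans (p_actT hg).symm, inv_actT hg⟩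
    · rintro x _ _ ⟨g, hg, rfl⟩ ⟨h, hh, rfl⟩
      have w : 𝒢.s h = 𝒢.r g := hh.trans (p_actT hg)
      exact ⟨𝒢.mul h g w, (𝒢.s_mul h g w).trans hg, act_mul_eq w hg⟩

/-- Saturations of open sets are open: if `gx ∈ U`, openness of `s` provides, for every `x'` near
`x`, an arrow `g'` near `g` starting at `p x'`, and `g'x'` stays in `U`. -/
theorem isOpenQuotientMap_orbit (hs : IsOpenMap 𝒢.s) (hp : Continuous p) :
    IsOpenQuotientMap (Quotient.mk α.orbitSetoid) := by
  refine ⟨Quotient.mk_surjective, continuous_quotient_mk', fun U hU => ?_⟩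
  rw [← isQuotientMap_quotient_mk'.isOpen_preimage, isOpen_iff_mem_nhds]
  rintro x ⟨y, hy, hyx⟩
  obtain ⟨g, hg, rfl⟩ := α.orbitSetoid.symm (Quotient.exact hyx)
  have h1 : {z : Pullback 𝒢.s p | α.act z.1.1 z.1.2 z.2 ∈ U} ∈ 𝓝 (⟨(g, x), hg⟩ : Pullback 𝒢.s p) :=
    α.continuous_act.continuousAt.preimage_mem_nhds (hU.mem_nhds (by
      change α.act g x hg ∈ U
      rwa [← actT_eq]))
  rw [nhds_subtype_eq_comap, mem_comap] at h1
  obtain ⟨u, hu, huU⟩ := h1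
  obtain ⟨a, ha, b, hb, hab⟩ := mem_nhds_prod_iff.1 hu
  have h2 : p ⁻¹' (𝒢.s '' a) ∈ 𝓝 x :=
    hp.continuousAt.preimage_mem_nhds (by rw [← hg]; exact hs.image_mem_nhds ha)
  filter_upwards [hb, h2] with x' hx' ⟨g', hg', hgx⟩
  exact ⟨α.act g' x' hgx, @huU ⟨(g', x'), hgx⟩ (hab ⟨hg', hx'⟩),
    Quotient.sound (α.orbitSetoid.symm ⟨g', hgx, actT_eq hgx⟩)⟩

/-- The orbit relation is the range of a proper map, hence closed, and a quotient by an open map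
with closed relation is Hausdorff. -/
theorem t2Space_orbit (hs : IsOpenMap 𝒢.s) (hp : Continuous p) (hα : α.IsProper) :
    T2Space (Quotient α.orbitSetoid) := by
  rw [t2Space_iff_of_isOpenQuotientMap (isOpenQuotientMap_orbit hs hp)]
  convert hα.isClosed_range using 1
  ext ⟨y, x⟩
  constructor
  · intro h
    obtain ⟨g, hg, hgx⟩ := α.orbitSetoid.symm (Quotient.exact h)
    exact ⟨⟨(g, x), hg⟩, Prod.ext ((actT_eq hg).symm.trans hgx) rfl⟩
  · rintro ⟨⟨⟨g, x⟩, hg⟩, h⟩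
    cases h
    exact Quotient.sound (α.orbitSetoid.symm ⟨g, hg, actT_eq hg⟩)

/-- For a proper action there are bump functions, subordinate to prescribed neighbourhoods, such
that the saturations of the sets where they do not vanish form a locally finite cover. -/
theorem exists_locallyFinite_isBump {X : Type u} [TopologicalSpace X] {p : X → G₀}
    {α : 𝒢.Action p} [T2Space X] [LocallyCompactSpace X]
    [SecondCountableTopology X] [T2Space G₀] [LocallyCompactSpace G₀] {V : Type*}
    [NormedAddCommGroup V] [NormedSpace ℝ V] [FiniteDimensional ℝ V] (A : ContinuousFamily V p)
    (hs : IsOpenMap 𝒢.s) (hα : α.IsProper) {N : X → Set X} (hN : ∀ x, N x ∈ 𝓝 x) :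
    ∃ (ι : Type u) (x : ι → X) (C : ι → Set X) (χ : ι → X → ℝ),
      (∀ i, IsBump A (C i) (χ i) ∧ C i ⊆ N (x i)) ∧
      (∀ y, ∃ i g, 𝒢.s g = p y ∧ χ i (α.actT g y) ≠ 0) ∧
      LocallyFinite fun i => {y | ∃ g, 𝒢.s g = p y ∧ χ i (α.actT g y) ≠ 0} := by
  have hπ := isOpenQuotientMap_orbit (α := α) hs A.continuous
  have := t2Space_orbit hs A.continuous hα
  have := hπ.locallyCompactSpace
  have : SigmaCompactSpace (Quotient α.orbitSetoid) := by
    have := isSigmaCompact_univ (X := X)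
    rw [← isSigmaCompact_univ_iff, ← hπ.surjective.range_eq]
    exact isSigmaCompact_range hπ.continuous
  -- Each bump function is placed near one representative of an orbit. The images of the sets of
  -- non-vanishing form neighbourhood bases in the orbit space, so its paracompactness yields the
  -- locally finite family.
  have hB : ∀ y : Quotient α.orbitSetoid, (𝓝 y).HasBasis
      (fun i : Set X × (X → ℝ) => IsBump A i.1 i.2 ∧ i.1 ⊆ N y.out ∧ i.2 y.out ≠ 0)
      (fun i => Quotient.mk α.orbitSetoid '' {x | i.2 x ≠ 0}) := by
    refine fun y => ⟨fun t => ⟨fun ht => ?_, ?_⟩⟩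
    · have h1 : Quotient.mk α.orbitSetoid ⁻¹' t ∈ 𝓝 y.out :=
        hπ.continuous.continuousAt.preimage_mem_nhds (by rwa [Quotient.out_eq])
      obtain ⟨C, χ, hχ, hC, h0⟩ := exists_isBump A (inter_mem (hN y.out) h1)
      refine ⟨(C, χ), ⟨hχ, hC.trans inter_subset_left, h0⟩, ?_⟩
      rintro _ ⟨x, hx, rfl⟩
      by_contra hxt
      exact hx (hχ.eq_zero x fun hxC => hxt (hC hxC).2)
    · rintro ⟨⟨C, χ⟩, ⟨hχ, -, h0⟩, hsub⟩
      refine mem_of_superset ?_ hsub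
      have hc : Continuous χ := continuous_iff_continuousAt.2 fun x => (hχ.smooth x).continuousAt
      exact (hπ.isOpenMap _ (isOpen_ne_fun hc continuous_const)).mem_nhds
        ⟨y.out, h0, Quotient.out_eq y⟩
  obtain ⟨ι, c, r, hr, hcov, hfin⟩ :=
    refinement_of_locallyCompact_sigmaCompact_of_nhds_basis hB
  have hset : ∀ i, {y | ∃ g, 𝒢.s g = p y ∧ (r i).2 (α.actT g y) ≠ 0} =
      Quotient.mk α.orbitSetoid ⁻¹' (Quotient.mk α.orbitSetoid '' {x | (r i).2 x ≠ 0}) := by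
    intro i
    ext y
    constructor
    · rintro ⟨g, hg, h⟩
      exact ⟨_, h, Quotient.sound (α.orbitSetoid.symm ⟨g, hg, rfl⟩)⟩
    · rintro ⟨x, hx, hxy⟩
      obtain ⟨g, hg, rfl⟩ := α.orbitSetoid.symm (Quotient.exact hxy)
      exact ⟨g, hg, hx⟩
  refine ⟨ι, fun i => (c i).out, fun i => (r i).1, fun i => (r i).2,
    fun i => ⟨(hr i).1, (hr i).2.1⟩, fun y => ?_, ?_⟩
  · obtain ⟨i, hi⟩ := iUnion_eq_univ_iff.1 hcov (Quotient.mk _ y)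
    have : y ∈ {y | ∃ g, 𝒢.s g = p y ∧ (r i).2 (α.actT g y) ≠ 0} := by
      rw [hset i]; exact hi
    exact ⟨i, this⟩
  · simp only [hset]
    exact hfin.preimage_continuous hπ.continuous

/-- For a proper action, the arrows that move points of a compact set into a compact set form a
compact set. -/
theorem IsProper.isCompact_arrows (hα : α.IsProper) {C D : Set X} (hC : IsCompact C)
    (hD : IsCompact D) :
    IsCompact {g | ∃ x ∈ D, 𝒢.r g = p x ∧ α.actT (𝒢.inv g) x ∈ C} := by
  -- Properness gives a compact set of pairs `(k, x)` with `kx ∈ C`, `x ∈ D`; the required set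
  -- consists of the inverses of their first components.
  have h1 := hα.isCompact_preimage (hC.prod hD)
  have h2 := ((h1.image continuous_subtype_val).image continuous_fst).image 𝒢.continuous_inv
  convert h2 using 1
  ext g
  constructor
  · rintro ⟨x, hx, hr, hg⟩
    have hs : 𝒢.s (𝒢.inv g) = p x := (𝒢.s_inv g).trans hr
    refine ⟨𝒢.inv g, ⟨(𝒢.inv g, x), ⟨⟨(𝒢.inv g, x), hs⟩, ⟨?_, hx⟩, rfl⟩, rfl⟩, inv_inv_eq g⟩
    change α.act _ _ _ ∈ C
    rwa [← actT_eq]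
  · rintro ⟨_, ⟨_, ⟨⟨⟨k, x⟩, hk⟩, ⟨hC', hD'⟩, rfl⟩, rfl⟩, rfl⟩
    refine ⟨x, hD', (𝒢.r_inv k).trans hk, ?_⟩
    rw [inv_inv_eq, actT_eq hk]
    exact hC'

end Action

end TopGroupoid

/-! ### Parametrized maps of class `C^{∞,0}` into continuous families -/

section Maps

variable {P W T X V T₂ X₂ V₂ E' : Type*} [TopologicalSpace P] [TopologicalSpace T]
  [TopologicalSpace X] [TopologicalSpace T₂] [TopologicalSpace X₂]
  [NormedAddCommGroup W] [NormedSpace ℝ W]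
  [NormedAddCommGroup V] [NormedSpace ℝ V] [FiniteDimensional ℝ V]
  [NormedAddCommGroup V₂] [NormedSpace ℝ V₂]
  [NormedAddCommGroup E'] [NormedSpace ℝ E'] {p : X → T} {p₂ : X₂ → T₂}

/-- Near `z`, the map `m` sends the slice over a parameter `t ∈ P` to the fibre of `X` over `q t`
and is of class `C^{∞,0}` in charts. -/
structure IsCInfZeroMapAt (A : ContinuousFamily V p) (q : P → T) (m : P × W → X) (z : P × W) :
    Prop where
  continuousAt_base : ContinuousAt q z.1
  continuousAt : ContinuousAt m z
  fiber : ∀ᶠ y in 𝓝 z, p (m y) = q y.1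
  chart : ∀ c ∈ A.atlas, m z ∈ c.source → IsCInfZeroAt (fun y => (c (m y)).2) z

variable {A : ContinuousFamily V p} {A₂ : ContinuousFamily V₂ p₂} {q : P → T} {m : P × W → X}
  {z : P × W}

theorem IsCInfZeroMapAt.comp_chart (hm : IsCInfZeroMapAt A q m z)
    {c : OpenPartialHomeomorph X (T × V)} (hc : c ∈ A.atlas) (hmc : m z ∈ c.source) {S : Type*}
    [TopologicalSpace S] {f : S × V → E'} {k : P → S} (hk : ContinuousAt k z.1)
    (hf : IsCInfZeroAt f (k z.1, (c (m z)).2)) : IsCInfZeroAt (fun y => f (k y.1, (c (m y)).2)) z :=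
  hf.comp hk (hm.chart c hc hmc)

theorem IsCInfZeroMapAt.eventually_symm (hm : IsCInfZeroMapAt A q m z)
    {c : OpenPartialHomeomorph X (T × V)} (hc : c ∈ A.atlas) (hmc : m z ∈ c.source) :
    ∀ᶠ y in 𝓝 z, c.symm (q y.1, (c (m y)).2) = m y := by
  filter_upwards [hm.fiber, hm.continuousAt.preimage_mem_nhds (c.open_source.mem_nhds hmc)]
    with y h1 h2
  rw [← h1, A.symm_chart hc h2]

theorem IsCInfZeroMapAt.chart_eq (hm : IsCInfZeroMapAt A q m z)
    {c : OpenPartialHomeomorph X (T × V)} (hc : c ∈ A.atlas) (hmc : m z ∈ c.source) :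
    (q z.1, (c (m z)).2) = c (m z) := by
  rw [← hm.fiber.self_of_nhds, A.chart_eq hc hmc]

theorem IsCInfZeroMapAt.comp_smooth (hm : IsCInfZeroMapAt A q m z) {f : X → E'}
    (hf : IsSmoothAt A f (m z)) : IsCInfZeroAt (fun y => f (m y)) z := by
  obtain ⟨c, hc, hmc⟩ := A.cover (m z)
  have h1 := hm.comp_chart hc hmc (f := fun v => f (c.symm v)) hm.continuousAt_base
    (by rw [hm.chart_eq hc hmc]; exact hf c hc hmc)
  refine h1.congr ?_
  filter_upwards [hm.eventually_symm hc hmc] with y hy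
  rw [hy]

theorem IsCInfZeroMapAt.comp_morphism (hm : IsCInfZeroMapAt A q m z) {q' : T → T₂} {f : X → X₂}
    {S : Set X} (hf : IsMorphismOn A A₂ q' f S) (hS : IsOpen S) (hmS : m z ∈ S) :
    IsCInfZeroMapAt A₂ (q' ∘ q) (f ∘ m) z where
  continuousAt_base := hf.continuous_base.continuousAt.comp hm.continuousAt_base
  continuousAt := (hf.continuousOn.continuousAt (hS.mem_nhds hmS)).comp hm.continuousAt
  fiber := by
    filter_upwards [hm.fiber, hm.continuousAt.preimage_mem_nhds (hS.mem_nhds hmS)] with y h1 h2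
    simp only [Function.comp_apply, hf.fiber _ h2, h1]
  chart c' hc' hmc' := by
    obtain ⟨c, hc, hmc⟩ := A.cover (m z)
    have h1 := hm.comp_chart hc hmc (f := fun v => (c' (f (c.symm v))).2) hm.continuousAt_base (by
      rw [hm.chart_eq hc hmc]
      refine hf.isCInfZeroAt hS hc hc' (c.map_source hmc) ?_ ?_
      · rwa [c.left_inv hmc]
      · rwa [c.left_inv hmc])
    refine h1.congr ?_
    filter_upwards [hm.eventually_symm hc hmc] with y hy
    rw [hy]
    rfl

theorem isCInfZeroMapAt_chart_symm {c : OpenPartialHomeomorph X (T × V)} (hc : c ∈ A.atlas)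
    {z : P × V} (hq : ContinuousAt q z.1) (hz : (q z.1, z.2) ∈ c.target) :
    IsCInfZeroMapAt A q (fun y : P × V => c.symm (q y.1, y.2)) z := by
  have h1 : ContinuousAt (fun y : P × V => (q y.1, y.2)) z :=
    (hq.comp (x := z) continuousAt_fst).prodMk continuousAt_snd
  refine ⟨hq, ContinuousAt.comp (f := fun y : P × V => (q y.1, y.2)) (c.continuousAt_symm hz) h1,
    ?_, fun c' hc' hmc' => ?_⟩
  · filter_upwards [h1.preimage_mem_nhds (c.open_target.mem_nhds hz)] with y hy
    exact A.p_symm hc hy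
  · have h2 := isCInfZeroAt_transition hc hc' (c.map_target hz) hmc'
    rw [c.right_inv hz] at h2
    exact h2.comp_base hq

/-- The arrow depends on the parameter alone, so its continuity is enough. With `k` the inversion of
`G`, this controls `(g, x) ↦ g⁻¹x`. -/
theorem IsCInfZeroMapAt.actT {G : Type*} [TopologicalSpace G] {𝒢 : TopGroupoid G T}
    {α : 𝒢.Action p} (hα : α.IsCInfZero A) (hm : IsCInfZeroMapAt A q m z) {k : P → G}
    (hk : ContinuousAt k z.1) (hkq : ∀ t, 𝒢.s (k t) = q t) :
    IsCInfZeroMapAt A (fun t => 𝒢.r (k t)) (fun y => α.actT (k y.1) (m y)) z where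
  continuousAt_base := 𝒢.continuous_r.continuousAt.comp hk
  continuousAt := by
    have h1 : 𝒢.s (k z.1) = p (m z) := (hkq _).trans hm.fiber.self_of_nhds.symm
    have h2 := (α.continuousOn_actT (k z.1, m z) h1).tendsto
    refine h2.comp (f := fun y : P × W => (k y.1, m y)) (tendsto_nhdsWithin_iff.2 ⟨?_, ?_⟩)
    · exact (hk.comp (x := z) continuousAt_fst).prodMk hm.continuousAt
    · filter_upwards [hm.fiber] with y hy
      exact (hkq _).trans hy.symm
  fiber := by
    filter_upwards [hm.fiber] with y hy
    exact TopGroupoid.Action.p_actT ((hkq _).trans hy.symm)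
  chart c' hc' hmc' := by
    obtain ⟨c, hc, hmc⟩ := A.cover (m z)
    have h0 : c.symm (𝒢.s (k z.1), (c (m z)).2) = m z := by
      rw [hkq, hm.chart_eq hc hmc, c.left_inv hmc]
    have h1 := hm.comp_chart hc hmc hk (TopGroupoid.Action.isCInfZeroAt_actT hα hc hc'
      (z := (k z.1, (c (m z)).2)) (by
        change (𝒢.s (k z.1), (c (m z)).2) ∈ c.target
        rw [hkq, hm.chart_eq hc hmc]
        exact c.map_source hmc) (by
        change α.actT (k z.1) (c.symm (𝒢.s (k z.1), (c (m z)).2)) ∈ c'.source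
        rwa [h0]))
    refine h1.congr ?_
    filter_upwards [hm.eventually_symm hc hmc] with y hy
    rw [hkq, hy]

theorem IsCInfZeroMapAt.snd_prodModel {F : Type*} [NormedAddCommGroup F] [NormedSpace ℝ F]
    {m : P × W → X × F} (hm : IsCInfZeroMapAt (A.prodModel F) q m z) :
    IsCInfZeroAt (fun y => (m y).2) z := by
  obtain ⟨c, hc, hmc⟩ := A.cover (m z).1
  have h1 := hm.chart _ ⟨c, hc, rfl⟩ (show _ ∧ _ from ⟨hmc, mem_univ _⟩)
  exact h1.contDiff_comp (c := fun v : V × F => v.2) contDiff_snd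

end Maps

/-! ### Averaged inner products -/

section Averaging

open TopGroupoid MeasureTheory

variable {G G₀ : Type*} [TopologicalSpace G] [TopologicalSpace G₀] {𝒢 : TopGroupoid G G₀}
  {V : Type*} [NormedAddCommGroup V] [NormedSpace ℝ V] [FiniteDimensional ℝ V]
  {R : ContinuousFamily V 𝒢.r}
  {X : Type*} [TopologicalSpace X] {p : X → G₀}
  {W : Type*} [NormedAddCommGroup W] [NormedSpace ℝ W] [FiniteDimensional ℝ W]
  {A : ContinuousFamily W p} {α : 𝒢.Action p}
  {F : Type*} [NormedAddCommGroup F] [NormedSpace ℂ F]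
  {E : X → Type*} [∀ x, AddCommGroup (E x)] [∀ x, Module ℂ (E x)]
  [∀ x, TopologicalSpace (E x)] [TopologicalSpace (TotalSpace F E)]
  {W' : Type*} [NormedAddCommGroup W'] [NormedSpace ℝ W'] [FiniteDimensional ℝ W']
  {B : ContinuousFamily W' (fun ξ : TotalSpace F E => p ξ.proj)}
  {β : GVectorBundle F E α}

/-- The choices needed to write down a compactly supported semi-definite metric on `E` and its
average over `G`. -/
structure MetricData (R : ContinuousFamily V 𝒢.r) (A : ContinuousFamily W p)
    (B : ContinuousFamily W' (fun ξ : TotalSpace F E => p ξ.proj)) where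
  haarData : HaarData R
  ε : Trivialization F (π F E)
  linear : ε.IsLinear ℂ
  morphism : IsMorphismOn B (A.prodModel F) id ε ε.source
  C : Set X
  χ : X → ℝ
  bump : IsBump A C χ
  sub_base : C ⊆ ε.baseSet
  sub_source : ∀ x ∈ C, 𝒢.unit (p x) ∈ haarData.e₀.source

namespace MetricData

variable {K : Type*} [NormedAddCommGroup K] [InnerProductSpace ℂ K] (L : F →L[ℂ] K)
  (D : MetricData R A B)

/-- The compactly supported semi-definite metric on `E`. -/
noncomputable def form (ξ η : TotalSpace F E) : ℂ :=
  D.χ ξ.proj • inner ℂ (L (D.ε ξ).2) (L (D.ε η).2)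

variable (β) in
/-- The function on the fibre of `r` over the base point of `ξ` and `η` whose integral is their
averaged inner product. -/
noncomputable def orbitForm (ξ η : TotalSpace F E) (g : G) : ℂ :=
  D.form L (β.totalAction.actT (𝒢.inv g) ξ) (β.totalAction.actT (𝒢.inv g) η)

variable (α) in
/-- The arrows `g` ending at `p x` such that `g⁻¹ x` is in the support of the compactly supported
metric. -/
def arrows (S : Set X) : Set G := {g | ∃ x ∈ S, 𝒢.r g = p x ∧ α.actT (𝒢.inv g) x ∈ D.C}

variable {L D}

theorem totalAction_actT {g : G} {x : X} (h : 𝒢.s g = p x) (v : E x) :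
    β.totalAction.actT g (TotalSpace.mk x v : TotalSpace F E) =
      TotalSpace.mk (α.act g x h) (β.fiberAct g x h v) :=
  Action.actT_eq (α := β.totalAction) (x := (TotalSpace.mk x v : TotalSpace F E)) h

theorem proj_actT {g : G} {ξ : TotalSpace F E} (h : 𝒢.s g = p ξ.proj) :
    (β.totalAction.actT g ξ).proj = α.actT g ξ.proj := by
  rw [Action.actT_eq (α := β.totalAction) h, Action.actT_eq h]
  rfl

theorem form_eq_zero {ξ : TotalSpace F E} (h : ξ.proj ∉ D.C) (η : TotalSpace F E) :
    D.form L ξ η = 0 := by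
  rw [form, D.bump.eq_zero _ h, zero_smul]

theorem orbitForm_eq_zero {ξ : TotalSpace F E} (η : TotalSpace F E) {g : G}
    (hg : 𝒢.r g = p ξ.proj) (h : α.actT (𝒢.inv g) ξ.proj ∉ D.C) :
    D.orbitForm β L ξ η g = 0 :=
  form_eq_zero (by rwa [proj_actT ((𝒢.s_inv g).trans hg)]) _

theorem arrows_subset (S : Set X) : D.arrows α S ⊆ 𝒢.sourceDomain D.haarData.e₀ := by
  rintro g ⟨x, -, hr, hC⟩
  have h1 := D.sub_source _ hC
  rwa [Action.p_actT ((𝒢.s_inv g).trans hr), 𝒢.r_inv] at h1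

theorem isCompact_arrows (hα : α.IsProper) {S : Set X} (hS : IsCompact S) :
    IsCompact (D.arrows α S) := hα.isCompact_arrows D.bump.isCompact hS

/-- Over `C` the trivialization is continuous. If the base point lies off the closed set `C`, it
stays off `C` nearby, and the form is zero whatever `ε` does there. -/
theorem continuousWithinAt_form [T2Space X] {S : Type*} [TopologicalSpace S] {s : Set S}
    {m m' : S → TotalSpace F E} {x : S} (hproj : Continuous (fun ξ : TotalSpace F E => ξ.proj))
    (hm : ContinuousWithinAt m s x) (hm' : ContinuousWithinAt m' s x)
    (hx : (m x).proj = (m' x).proj) :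
    ContinuousWithinAt (fun y => D.form L (m y) (m' y)) s x := by
  have hp : ContinuousWithinAt (fun y => (m y).proj) s x :=
    hproj.continuousAt.comp_continuousWithinAt hm
  by_cases hC : (m x).proj ∈ D.C
  · have h1 : ∀ {m : S → TotalSpace F E}, ContinuousWithinAt m s x → (m x).proj ∈ D.C →
        ContinuousWithinAt (fun y => L (D.ε (m y)).2) s x := fun {m} hm hC =>
      L.continuous.continuousAt.comp_continuousWithinAt
        (continuousAt_snd.comp_continuousWithinAt
          ((D.ε.continuousAt (D.ε.mem_source.2 (D.sub_base hC))).comp_continuousWithinAt hm))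
    exact ((D.bump.smooth _).continuousAt.comp_continuousWithinAt hp).smul
      ((h1 hm hC).inner (h1 hm' (hx ▸ hC)))
  · have h2 := hp (D.bump.isCompact.isClosed.isOpen_compl.mem_nhds hC)
    refine (continuousWithinAt_const (b := (0 : ℂ))).congr_of_eventuallyEq ?_
      (form_eq_zero hC _)
    filter_upwards [h2] with y hy using form_eq_zero hy _

theorem isTest_orbitForm [T2Space X] (hα : α.IsProper)
    (hproj : Continuous (fun ξ : TotalSpace F E => ξ.proj)) {x : X} {ξ η : TotalSpace F E}
    (hξ : ξ.proj = x) (hη : η.proj = x) :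
    IsTest D.haarData (p x) (D.arrows α {x}) (D.orbitForm β L ξ η) where
  isCompact := isCompact_arrows hα isCompact_singleton
  subset := arrows_subset _
  continuousOn := by
    have h1 : ∀ ξ : TotalSpace F E, ξ.proj = x →
        ContinuousOn (fun g => β.totalAction.actT (𝒢.inv g) ξ) {g | 𝒢.r g = p x} := fun ξ hξ =>
      β.totalAction.continuousOn_actT.comp (f := fun g => (𝒢.inv g, ξ))
        (𝒢.continuous_inv.continuousOn.prodMk continuousOn_const) fun g hg =>
          (𝒢.s_inv g).trans (hξ ▸ hg)
    intro g hg
    refine continuousWithinAt_form hproj (h1 ξ hξ g hg) (h1 η hη g hg) ?_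
    rw [proj_actT ((𝒢.s_inv g).trans (hξ ▸ hg)), proj_actT ((𝒢.s_inv g).trans (hη ▸ hg)), hξ, hη]
  eq_zero g hg hK := by
    subst hξ
    exact orbitForm_eq_zero η hg fun h => hK ⟨_, rfl, hg, h⟩

/-- `ε` is linear only over its base set; off `C` the cutoff makes the identity trivial. -/
theorem form_mk_add_left {x : X} (v v' : E x) (η : TotalSpace F E) :
    D.form L (TotalSpace.mk x (v + v')) η =
      D.form L (TotalSpace.mk x v) η + D.form L (TotalSpace.mk x v') η := by
  by_cases hC : x ∈ D.C
  · have := D.linear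
    have h := (D.ε.linear ℂ (D.sub_base hC)).map_add v v'
    simp only [form, h, map_add, inner_add_left, smul_add]
  · simp only [form, D.bump.eq_zero _ hC, zero_smul, add_zero]

theorem form_mk_smul_left {x : X} (a : ℂ) (v : E x) (η : TotalSpace F E) :
    D.form L (TotalSpace.mk x (a • v)) η = conj a * D.form L (TotalSpace.mk x v) η := by
  by_cases hC : x ∈ D.C
  · have := D.linear
    have h := (D.ε.linear ℂ (D.sub_base hC)).map_smul a v
    simp only [form, h, map_smul, inner_smul_left, Complex.real_smul]
    ring
  · simp only [form, D.bump.eq_zero _ hC, zero_smul, mul_zero]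

theorem form_conj {ξ η : TotalSpace F E} (h : ξ.proj = η.proj) :
    conj (D.form L η ξ) = D.form L ξ η := by
  rw [form, form, h, Complex.real_smul, Complex.real_smul, map_mul, Complex.conj_ofReal,
    inner_conj_symm]

theorem orbitForm_conj {ξ η : TotalSpace F E} (h : ξ.proj = η.proj) {g : G}
    (hg : 𝒢.r g = p ξ.proj) : conj (D.orbitForm β L η ξ g) = D.orbitForm β L ξ η g :=
  form_conj (by rw [proj_actT ((𝒢.s_inv g).trans hg), proj_actT ((𝒢.s_inv g).trans (h ▸ hg)), h])

theorem orbitForm_add_left {x : X} (v v' : E x) (η : TotalSpace F E) {g : G} (hg : 𝒢.r g = p x) :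
    D.orbitForm β L (TotalSpace.mk x (v + v')) η g =
      D.orbitForm β L (TotalSpace.mk x v) η g + D.orbitForm β L (TotalSpace.mk x v') η g := by
  have hs := (𝒢.s_inv g).trans hg
  simp only [orbitForm, totalAction_actT hs, map_add, form_mk_add_left]

theorem orbitForm_smul_left {x : X} (a : ℂ) (v : E x) (η : TotalSpace F E) {g : G}
    (hg : 𝒢.r g = p x) : D.orbitForm β L (TotalSpace.mk x (a • v)) η g =
      conj a * D.orbitForm β L (TotalSpace.mk x v) η g := by
  have hs := (𝒢.s_inv g).trans hg
  simp only [orbitForm, totalAction_actT hs, map_smul, form_mk_smul_left]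

theorem orbitForm_self (ξ : TotalSpace F E) (g : G) : D.orbitForm β L ξ ξ g =
    ((D.χ (β.totalAction.actT (𝒢.inv g) ξ).proj *
      ‖L (D.ε (β.totalAction.actT (𝒢.inv g) ξ)).2‖ ^ 2 : ℝ) : ℂ) := by
  rw [orbitForm, form, inner_self_eq_norm_sq_to_K, Complex.real_smul]
  push_cast
  rfl

variable [MeasurableSpace V] [BorelSpace V] (μ : Measure V) [μ.IsAddHaarMeasure] [T2Space G]
  [T2Space G₀] [T2Space X]

variable (β L D) in
/-- The averaged inner product. -/
noncomputable def average (ξ η : TotalSpace F E) : ℂ :=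
  haar D.haarData μ (p ξ.proj) (D.orbitForm β L ξ η)

variable {μ}

theorem average_conj (hR : 𝒢.leftMul.IsCInfZero R) (hα : α.IsProper)
    (hproj : Continuous (fun ξ : TotalSpace F E => ξ.proj)) {ξ η : TotalSpace F E}
    (h : ξ.proj = η.proj) : conj (D.average β L μ η ξ) = D.average β L μ ξ η := by
  have h1 := haar_clm (μ := μ) hR Complex.conjCLE.toContinuousLinearMap
    (isTest_orbitForm (β := β) (L := L) (D := D) hα hproj (ξ := η) (η := ξ) rfl h)
  refine h1.symm.trans ?_
  rw [average, h]
  exact haar_congr fun g hg => orbitForm_conj h (h ▸ hg)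

theorem average_add_left (hR : 𝒢.leftMul.IsCInfZero R) (hα : α.IsProper)
    (hproj : Continuous (fun ξ : TotalSpace F E => ξ.proj)) {x : X} (v v' w : E x) :
    D.average β L μ (TotalSpace.mk x (v + v')) (TotalSpace.mk x w) =
      D.average β L μ (TotalSpace.mk x v) (TotalSpace.mk x w) +
      D.average β L μ (TotalSpace.mk x v') (TotalSpace.mk x w) := by
  have h1 := haar_add (μ := μ) hR
    (isTest_orbitForm (β := β) (L := L) (D := D) hα hproj (ξ := TotalSpace.mk x v)
      (η := TotalSpace.mk x w) rfl rfl)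
    (isTest_orbitForm (β := β) (L := L) (D := D) hα hproj (ξ := TotalSpace.mk x v')
      (η := TotalSpace.mk x w) rfl rfl)
  exact (haar_congr fun g hg => orbitForm_add_left v v' _ hg).trans h1

theorem average_smul_left (hR : 𝒢.leftMul.IsCInfZero R) (hα : α.IsProper)
    (hproj : Continuous (fun ξ : TotalSpace F E => ξ.proj)) {x : X} (a : ℂ) (v w : E x) :
    D.average β L μ (TotalSpace.mk x (a • v)) (TotalSpace.mk x w) =
      conj a * D.average β L μ (TotalSpace.mk x v) (TotalSpace.mk x w) := by
  have h1 := haar_clm (μ := μ) hR ((ContinuousLinearMap.mul ℂ ℂ (conj a)).restrictScalars ℝ)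
    (isTest_orbitForm (β := β) (L := L) (D := D) hα hproj (ξ := TotalSpace.mk x v)
      (η := TotalSpace.mk x w) rfl rfl)
  exact (haar_congr fun g hg => orbitForm_smul_left a v _ hg).trans h1

theorem average_add_right (hR : 𝒢.leftMul.IsCInfZero R) (hα : α.IsProper)
    (hproj : Continuous (fun ξ : TotalSpace F E => ξ.proj)) {x : X} (v w w' : E x) :
    D.average β L μ (TotalSpace.mk x v) (TotalSpace.mk x (w + w')) =
      D.average β L μ (TotalSpace.mk x v) (TotalSpace.mk x w) +
      D.average β L μ (TotalSpace.mk x v) (TotalSpace.mk x w') := by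
  -- Hermitian symmetry transfers additivity from the first variable to the second.
  have hc := fun w : E x => average_conj (β := β) (L := L) (D := D) (μ := μ) hR hα hproj
    (ξ := TotalSpace.mk x v) (η := TotalSpace.mk x w) rfl
  rw [← hc, ← hc, ← hc, average_add_left hR hα hproj, map_add]

theorem average_smul_right (hR : 𝒢.leftMul.IsCInfZero R) (hα : α.IsProper)
    (hproj : Continuous (fun ξ : TotalSpace F E => ξ.proj)) {x : X} (a : ℂ) (v w : E x) :
    D.average β L μ (TotalSpace.mk x v) (TotalSpace.mk x (a • w)) =
      a * D.average β L μ (TotalSpace.mk x v) (TotalSpace.mk x w) := by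
  have hc := fun w : E x => average_conj (β := β) (L := L) (D := D) (μ := μ) hR hα hproj
    (ξ := TotalSpace.mk x v) (η := TotalSpace.mk x w) rfl
  rw [← hc, ← hc, average_smul_left hR hα hproj, map_mul, Complex.conj_conj]

variable (β L D μ) in
/-- The averaged inner product, as a sesquilinear form on the fibres of `E`. -/
noncomputable def averageForm (hR : 𝒢.leftMul.IsCInfZero R) (hα : α.IsProper)
    (hproj : Continuous (fun ξ : TotalSpace F E => ξ.proj)) (x : X) :
    E x →ₗ⋆[ℂ] E x →ₗ[ℂ] ℂ :=
  LinearMap.mk₂'ₛₗ (starRingEnd ℂ) (RingHom.id ℂ)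
    (fun v w => D.average β L μ (TotalSpace.mk x v) (TotalSpace.mk x w))
    (average_add_left hR hα hproj)
    (average_smul_left hR hα hproj)
    (average_add_right hR hα hproj)
    (average_smul_right hR hα hproj)

/-- Confines each average to the saturation of its cutoff, so that the later sum is locally finite.
-/
theorem average_eq_zero {ξ : TotalSpace F E} (η : TotalSpace F E)
    (h : ∀ g, 𝒢.s g = p ξ.proj → D.χ (α.actT g ξ.proj) = 0) : D.average β L μ ξ η = 0 := by
  have h1 : haar D.haarData μ (p ξ.proj) (D.orbitForm β L ξ η) =
      haar D.haarData μ (p ξ.proj) (fun _ => (0 : ℂ)) := by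
    refine haar_congr fun g hg => ?_
    have hs := (𝒢.s_inv g).trans hg
    rw [orbitForm, form, proj_actT hs, h _ hs, zero_smul]
  rw [average, h1]
  exact finsum_eq_zero_of_forall_eq_zero fun e => by simp [chartInt, integrand]

theorem average_self (hR : 𝒢.leftMul.IsCInfZero R) (hα : α.IsProper)
    (hproj : Continuous (fun ξ : TotalSpace F E => ξ.proj)) (ξ : TotalSpace F E) :
    (D.average β L μ ξ ξ).re =
      haar D.haarData μ (p ξ.proj) fun g => (D.orbitForm β L ξ ξ g).re :=
  (haar_clm (μ := μ) hR Complex.reCLM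
    (isTest_orbitForm (β := β) (L := L) (D := D) hα hproj (ξ := ξ) (η := ξ) rfl rfl)).symm

theorem orbitForm_self_nonneg (ξ : TotalSpace F E) (g : G) :
    0 ≤ (D.orbitForm β L ξ ξ g).re := by
  rw [orbitForm_self, Complex.ofReal_re]
  exact mul_nonneg (D.bump.nonneg _) (sq_nonneg _)

theorem average_self_nonneg (hR : 𝒢.leftMul.IsCInfZero R) (hα : α.IsProper)
    (hproj : Continuous (fun ξ : TotalSpace F E => ξ.proj)) (ξ : TotalSpace F E) :
    0 ≤ (D.average β L μ ξ ξ).re := by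
  rw [average_self hR hα hproj]
  exact haar_nonneg fun g _ => orbitForm_self_nonneg ξ g

/-- The inverse arrow recovers `v` from its image. -/
theorem fiberAct_ne_zero {g : G} {x : X} (w : 𝒢.s g = p x) {v : E x} (hv : v ≠ 0) :
    β.fiberAct g x w v ≠ 0 := by
  intro h0
  have h1 := β.inv_act g x w v
  have h2 := β.inv_act g x w 0
  rw [h0] at h1
  rw [map_zero] at h2
  have h3 := h1.symm.trans h2
  exact hv (by simpa using h3)

theorem average_self_pos (hR : 𝒢.leftMul.IsCInfZero R) (hα : α.IsProper)
    (hproj : Continuous (fun ξ : TotalSpace F E => ξ.proj)) (hL : Function.Injective L) {x : X}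
    {v : E x} (hv : v ≠ 0) {g : G} (hg : 𝒢.s g = p x) (hχ : D.χ (α.actT g x) ≠ 0) :
    0 < (D.average β L μ (TotalSpace.mk x v) (TotalSpace.mk x v)).re := by
  rw [average_self hR hα hproj]
  have ht := isTest_orbitForm (β := β) (L := L) (D := D) hα hproj (ξ := TotalSpace.mk x v)
      (η := TotalSpace.mk x v) rfl rfl
  have ht' : IsTest D.haarData (p x) (D.arrows α {x})
      fun g => (D.orbitForm β L (TotalSpace.mk x v) (TotalSpace.mk x v) g).re :=
    ⟨ht.isCompact, ht.subset, Complex.continuous_re.comp_continuousOn ht.continuousOn,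
      fun g hg hK => by rw [ht.eq_zero g hg hK, Complex.zero_re]⟩
  -- At the arrow `g⁻¹` the integrand is `χ(gx)` times the squared norm of `L` applied to the
  -- coordinate of `gv`, and both factors are nonzero.
  refine haar_pos hR ht' (fun g _ => orbitForm_self_nonneg _ g) (g := 𝒢.inv g)
    ((𝒢.r_inv g).trans hg) ?_
  rw [orbitForm_self, Complex.ofReal_re, inv_inv_eq, totalAction_actT hg]
  rw [Action.actT_eq hg] at hχ
  have hC : α.act g x hg ∈ D.C := by
    by_contra hC
    exact hχ (D.bump.eq_zero _ hC)
  refine mul_ne_zero hχ (pow_ne_zero 2 (norm_ne_zero_iff.2 ?_))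
  have := D.linear
  rw [← map_zero L, hL.ne_iff]
  intro h0
  refine fiberAct_ne_zero (β := β) hg hv ?_
  have h1 := (D.ε.linear ℂ (D.sub_base hC)).map_zero
  have hmem : ∀ v : E (α.act g x hg), (TotalSpace.mk _ v : TotalSpace F E) ∈ D.ε.source :=
    fun v => D.ε.mem_source.2 (D.sub_base hC)
  have h2 := D.ε.injOn (hmem (β.fiberAct g x hg v)) (hmem 0) (Prod.ext
    ((D.ε.coe_fst (hmem _)).trans (D.ε.coe_fst (hmem 0)).symm) (h0.trans h1.symm))
  simpa using h2

/-- The averaged inner product is invariant. -/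
theorem average_actT (hR : 𝒢.leftMul.IsCInfZero R) (hα : α.IsProper)
    (hproj : Continuous (fun ξ : TotalSpace F E => ξ.proj)) {g : G} {ξ η : TotalSpace F E}
    (hg : 𝒢.s g = p ξ.proj) (h : ξ.proj = η.proj) :
    D.average β L μ (β.totalAction.actT g ξ) (β.totalAction.actT g η) = D.average β L μ ξ η := by
  have hg' : 𝒢.s g = p η.proj := h ▸ hg
  have hp : p (β.totalAction.actT g ξ).proj = 𝒢.r g := Action.p_actT (α := β.totalAction) hg
  have ht := isTest_orbitForm (β := β) (L := L) (D := D) hα hproj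
    (ξ := β.totalAction.actT g ξ) (η := β.totalAction.actT g η) rfl
    (by rw [proj_actT hg, proj_actT hg', h])
  rw [hp] at ht
  -- After translation by `g` the integrand at `k` involves `(gk)⁻¹gξ`, which is `k⁻¹ξ`.
  rw [average, hp, ← haar_translate hR ht, average, hg]
  refine haar_congr fun k hk => ?_
  have hgk : 𝒢.s g = 𝒢.r k := hg.trans hk.symm
  rw [leftMul_actT hgk, orbitForm, Action.inv_mul_actT (α := β.totalAction) hgk hk,
    Action.inv_mul_actT (α := β.totalAction) hgk (hk.trans (congrArg p h)), orbitForm]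

/-- The averaged inner product of two sections of class `C^{∞,0}` is of class `C^{∞,0}`. -/
theorem isSmoothAt_average [LocallyCompactSpace X] (hR : 𝒢.leftMul.IsCInfZero R)
    (hαA : α.IsCInfZero A) (hα : α.IsProper) (hβ : β.totalAction.IsCInfZero B) {σ τ : ∀ x, E x}
    (hσ : IsCInfZeroSection F E A B σ) (hτ : IsCInfZeroSection F E A B τ) (x : X) :
    IsSmoothAt A (fun x => D.average β L μ (TotalSpace.mk x (σ x)) (TotalSpace.mk x (τ x))) x := by
  intro c hc hx
  -- One compact set of arrows must serve all base points near `x`; properness supplies it for base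
  -- points in the compact neighbourhood `S`.
  obtain ⟨S, hS, hSc⟩ := exists_compact_mem_nhds x
  have hΩ : IsOpen (c.target ∩ c.symm ⁻¹' interior S) :=
    c.isOpen_inter_preimage_symm isOpen_interior
  -- The parameter of the base point is read off from the arrow, which makes the integrand a
  -- function on `G × W`. On the fibre of `r` over `z.1`, `M (g, z.2)` is the point `c.symm z`.
  let M : G × W → X := fun y => c.symm (𝒢.r y.1, y.2)
  let sec : (∀ x, E x) → X → TotalSpace F E := fun σ x => TotalSpace.mk x (σ x)
  let Ψ : G × W → ℂ := fun y => D.orbitForm β L (sec σ (M y)) (sec τ (M y)) y.1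
  have key : IsCInfZeroAt (fun z : G₀ × W => haar D.haarData μ z.1 fun g => Ψ (g, z.2)) (c x) := by
    refine isCInfZeroAt_haar hR hΩ (isCompact_arrows (D := D) hα hS) (arrows_subset S)
      (fun g w hw => ?_) (fun g w hw hg => ?_)
      ⟨c.map_source hx, by rwa [mem_preimage, c.left_inv hx, mem_interior_iff_mem_nhds]⟩
    · have hM : IsCInfZeroMapAt A 𝒢.r M (g, w) :=
        isCInfZeroMapAt_chart_symm (z := (g, w)) hc 𝒢.continuous_r.continuousAt hw.1
      have hM' := hM.actT hαA 𝒢.continuous_inv.continuousAt 𝒢.s_inv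
      have hr : 𝒢.r g = p (M (g, w)) := hM.fiber.self_of_nhds.symm
      by_cases hC : α.actT (𝒢.inv g) (M (g, w)) ∈ D.C
      · have hsec : ∀ σ : (∀ x, E x), IsCInfZeroSection F E A B σ → IsCInfZeroAt
            (fun y : G × W => (D.ε (β.totalAction.actT (𝒢.inv y.1) (sec σ (M y)))).2) (g, w) := by
          intro σ hσ
          have h1 := (hM.comp_morphism hσ isOpen_univ (mem_univ _)).actT hβ
            𝒢.continuous_inv.continuousAt 𝒢.s_inv
          refine (h1.comp_morphism D.morphism D.ε.open_source ?_).snd_prodModel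
          refine D.ε.mem_source.2 (D.sub_base ?_)
          have h2 := proj_actT (β := β) (ξ := sec σ (M (g, w))) ((𝒢.s_inv g).trans hr)
          exact Eq.subst (motive := fun x => x ∈ D.C) h2.symm hC
        have hin : ContDiff ℝ ∞ fun v : F × F => (inner ℂ (L v.1) (L v.2) : ℂ) := by
          have hL : ContDiff ℝ ∞ L := (L.restrictScalars ℝ).contDiff
          exact (hL.comp contDiff_fst).inner ℂ (hL.comp contDiff_snd)
        refine ((hM'.comp_smooth (D.bump.smooth _)).smul
          (((hsec σ hσ).prodMk (hsec τ hτ)).contDiff_comp hin)).congr ?_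
        filter_upwards [hM.fiber] with y hy
        have h2 := proj_actT (β := β) (ξ := sec σ (M y)) ((𝒢.s_inv y.1).trans hy.symm)
        change _ = D.χ _ • _
        rw [h2]
      · refine (isCInfZeroAt_of_continuousAt (a := fun _ : G => (0 : ℂ)) continuousAt_const).congr ?_
        have hev := hM'.continuousAt.preimage_mem_nhds
          (D.bump.isCompact.isClosed.isOpen_compl.mem_nhds hC)
        filter_upwards [hM.fiber, hev] with y hy hyC
        exact (orbitForm_eq_zero (β := β) (ξ := sec σ (M y)) _ hy.symm hyC).symm
    · have hr : 𝒢.r g = p (M (g, w)) := (A.p_symm hc hw.1).symm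
      exact orbitForm_eq_zero (β := β) (ξ := sec σ (M (g, w))) _ hr fun hC =>
        hg ⟨_, interior_subset hw.2, hr, hC⟩
  refine key.congr ?_
  filter_upwards [c.open_target.mem_nhds (c.map_source hx)] with z hz
  have hp : p (c.symm z) = z.1 := A.p_symm hc hz
  rw [average, hp]
  refine haar_congr fun g hg => ?_
  change D.orbitForm β L (sec σ (c.symm (𝒢.r g, z.2))) (sec τ (c.symm (𝒢.r g, z.2))) g = _
  rw [hg]

end MetricData

end Averaging

/-! ### The invariant metric -/

section InvariantMetric

open TopGroupoid MeasureTheory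

variable {G G₀ : Type*} [TopologicalSpace G] [TopologicalSpace G₀] {𝒢 : TopGroupoid G G₀}
  {V : Type*} [NormedAddCommGroup V] [NormedSpace ℝ V] [FiniteDimensional ℝ V]
  {R : ContinuousFamily V 𝒢.r}
  {X : Type*} [TopologicalSpace X] {p : X → G₀}
  {W : Type*} [NormedAddCommGroup W] [NormedSpace ℝ W] [FiniteDimensional ℝ W]
  {A : ContinuousFamily W p} {α : 𝒢.Action p}
  {F : Type*} [NormedAddCommGroup F] [NormedSpace ℂ F]
  {E : X → Type*} [∀ x, AddCommGroup (E x)] [∀ x, Module ℂ (E x)]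
  [∀ x, TopologicalSpace (E x)] [TopologicalSpace (TotalSpace F E)]
  {W' : Type*} [NormedAddCommGroup W'] [NormedSpace ℝ W'] [FiniteDimensional ℝ W']
  {B : ContinuousFamily W' (fun ξ : TotalSpace F E => p ξ.proj)}
  {β : GVectorBundle F E α}

variable (α) in
/-- The saturation of the set where the bump function of `D` does not vanish. -/
def MetricData.saturation (D : MetricData R A B) : Set X :=
  {y | ∃ g, 𝒢.s g = p y ∧ D.χ (α.actT g y) ≠ 0}

/-- A locally finite family of averaged inner products whose supports cover `X` adds up to an
invariant metric. -/
theorem exists_invariant_metric [T2Space G] [T2Space G₀] [T2Space X] [LocallyCompactSpace X]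
    (hR : 𝒢.leftMul.IsCInfZero R) (hαA : α.IsCInfZero A) (hα : α.IsProper)
    (hβ : β.totalAction.IsCInfZero B) (hproj : Continuous (fun ξ : TotalSpace F E => ξ.proj))
    {K : Type*} [NormedAddCommGroup K] [InnerProductSpace ℂ K] {L : F →L[ℂ] K}
    (hL : Function.Injective L) {ι : Type*} (D : ι → MetricData R A B)
    (hcov : ∀ y, ∃ i, y ∈ (D i).saturation α) (hfin : LocallyFinite fun i => (D i).saturation α) :
    ∃ γ : HermitianMetric E, γ.IsCInfZero F A B ∧ γ.IsGIsometric β := by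
  classical
  borelize V
  let μ : Measure V := Measure.addHaar
  let Q : ι → ∀ x, E x →ₗ⋆[ℂ] E x →ₗ[ℂ] ℂ := fun i =>
    (D i).averageForm β L μ hR hα hproj
  have hQ0 : ∀ i x, x ∉ (D i).saturation α → Q i x = 0 := by
    intro i x hx
    ext v w
    refine MetricData.average_eq_zero (ξ := TotalSpace.mk x v) (TotalSpace.mk x w) fun g hg => ?_
    by_contra h0
    exact hx ⟨g, hg, h0⟩
  -- Any finite set containing the active indices may be used, so one set can serve a whole
  -- neighbourhood, or both `x` and `gx`.
  have hsum : ∀ (t : Finset ι) (x : X), (∀ i ∉ t, x ∉ (D i).saturation α) → ∀ v w : E x,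
      (∑ᶠ i, Q i x) v w = ∑ i ∈ t, Q i x v w := by
    intro t x ht v w
    rw [finsum_eq_sum_of_support_subset (s := t) _ fun i hi => ?_]
    · simp only [LinearMap.sum_apply]
    · by_contra hit
      exact hi (hQ0 i x (ht i hit))
  have hpt : ∀ x, ∃ t : Finset ι, ∀ i, i ∉ t ↔ x ∉ (D i).saturation α := fun x =>
    ⟨(hfin.point_finite x).toFinset, fun i => by simp⟩
  refine ⟨⟨fun x => ∑ᶠ i, Q i x, fun x v w => ?_, fun x v hv => ?_⟩, fun σ τ hσ hτ => ?_, ?_⟩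
  · obtain ⟨t, ht⟩ := hpt x
    rw [hsum t x (fun i => (ht i).1), hsum t x (fun i => (ht i).1), map_sum]
    exact Finset.sum_congr rfl fun i _ => MetricData.average_conj hR hα hproj
      (ξ := TotalSpace.mk x v) (η := TotalSpace.mk x w) rfl
  · obtain ⟨t, ht⟩ := hpt x
    obtain ⟨i, g, hg, hχ⟩ := hcov x
    have hi : i ∈ t := by
      by_contra hi
      exact (ht i).1 hi ⟨g, hg, hχ⟩
    rw [hsum t x (fun i => (ht i).1), Complex.re_sum]
    exact Finset.sum_pos' (fun j _ => MetricData.average_self_nonneg hR hα hproj _)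
      ⟨i, hi, MetricData.average_self_pos hR hα hproj hL hv hg hχ⟩
  · refine isMorphism_point fun x => ?_
    obtain ⟨U, hU, hUf⟩ := hfin x
    refine (isSmoothAt_sum hUf.toFinset fun i _ => MetricData.isSmoothAt_average (D := D i) (L := L)
      (β := β) (μ := μ) hR hαA hα hβ hσ hτ x).congr ?_
    filter_upwards [hU] with y hy
    refine (hsum _ y (fun i hi hiy => hi ?_) (σ y) (τ y)).symm
    simpa using ⟨y, hiy, hy⟩
  · intro g x w ξ η
    obtain ⟨t, ht⟩ := hpt x
    obtain ⟨t', ht'⟩ := hpt (α.act g x w)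
    rw [hsum (t ∪ t') x fun i hi => (ht i).1 fun h => hi (Finset.mem_union_left _ h),
      hsum (t ∪ t') _ fun i hi => (ht' i).1 fun h => hi (Finset.mem_union_right _ h)]
    refine Finset.sum_congr rfl fun i _ => ?_
    have h := MetricData.average_actT (D := D i) (L := L) (β := β) (μ := μ) hR hα hproj (g := g)
      (ξ := TotalSpace.mk x ξ) (η := TotalSpace.mk x η) w rfl
    rw [MetricData.totalAction_actT w, MetricData.totalAction_actT w] at h
    exact h

end InvariantMetric

end CFam

/-! ### Existence of the invariant metric -/

theorem mainTheorem8
    {G G₀ : Type*} [TopologicalSpace G] [T2Space G] [LocallyCompactSpace G]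
    [SecondCountableTopology G] [TopologicalSpace G₀]
    (𝒢 : CFam.TopGroupoid G G₀)
    {V : Type*} [NormedAddCommGroup V] [NormedSpace ℝ V] [FiniteDimensional ℝ V]
    (_h𝒢 : 𝒢.ContinuousFamilyStructure V)
    {X : Type*} [TopologicalSpace X] [T2Space X] [LocallyCompactSpace X]
    [SecondCountableTopology X] {p : X → G₀}
    {W : Type*} [NormedAddCommGroup W] [NormedSpace ℝ W] [FiniteDimensional ℝ W]
    (A : CFam.ContinuousFamily W p)
    (α : 𝒢.Action p) (_hα : α.IsCInfZero A) (_hproper : α.IsProper)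
    (F : Type*) [NormedAddCommGroup F] [NormedSpace ℂ F] [FiniteDimensional ℂ F]
    (E : X → Type*) [∀ x, AddCommGroup (E x)] [∀ x, Module ℂ (E x)]
    [∀ x, TopologicalSpace (E x)] [TopologicalSpace (TotalSpace F E)]
    [FiberBundle F E] [VectorBundle ℂ F E]
    {W' : Type*} [NormedAddCommGroup W'] [NormedSpace ℝ W'] [FiniteDimensional ℝ W']
    (B : CFam.ContinuousFamily W' (fun ξ : TotalSpace F E => p ξ.proj))
    (β : CFam.GVectorBundle F E α) (_hβ : CFam.IsCInfZeroGVectorBundle F E A B β) :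
    ∃ γ : CFam.HermitianMetric E, γ.IsCInfZero F A B ∧ γ.IsGIsometric β := by
  have := 𝒢.t2Space_units
  have := 𝒢.locallyCompactSpace_units _h𝒢.famR.isOpenMap
  choose H hH using fun x => CFam.TopGroupoid.exists_haarData _h𝒢.famR (p x)
  choose ε hε hlin hmor _ using _hβ.vectorBundle
  -- On this neighbourhood `E` is trivialized and the units over `p y` lie in the normalizing chart:
  -- exactly what a cutoff supported there needs to form `MetricData`.
  have hN : ∀ x, (ε x).baseSet ∩ {y | 𝒢.unit (p y) ∈ (H x).e₀.source} ∈ 𝓝 x := fun x =>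
    inter_mem ((ε x).open_baseSet.mem_nhds (hε x))
      (((H x).e₀.open_source.preimage
        (𝒢.isEmbedding_unit.continuous.comp A.continuous)).mem_nhds (hH x))
  obtain ⟨ι, x, C, χ, hχ, hcov, hfin⟩ := CFam.TopGroupoid.Action.exists_locallyFinite_isBump
    A _h𝒢.famS.isOpenMap _hproper hN
  let D : ι → CFam.MetricData _h𝒢.famR A B := fun i =>
    { haarData := H (x i)
      ε := ε (x i)
      linear := hlin (x i)
      morphism := hmor (x i)
      C := C i
      χ := χ i
      bump := (hχ i).1
      sub_base := fun y hy => ((hχ i).2 hy).1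
      sub_source := fun y hy => ((hχ i).2 hy).2 }
  -- The norm of `F` need not come from an inner product, so one is transported from Euclidean space
  -- of the same dimension.
  let L : F ≃L[ℂ] EuclideanSpace ℂ (Fin (Module.finrank ℂ F)) :=
    ContinuousLinearEquiv.ofFinrankEq (by simp)
  exact CFam.exists_invariant_metric _h𝒢.mul _hα _hproper _hβ.gSpace
    (FiberBundle.continuous_proj F E) (L := L.toContinuousLinearMap) L.injective D hcov hfin
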